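/- Definitions. A simplicial complex $\Delta$ is a finite collection of finite sets closed under taking subsets; its members are its faces, $\dim F=|F|-1$ for a face $F$, and $\dim\Delta$ is the maximum of the dimensions of its faces. For a finite collection $\mathcal S$ of finite sets, $\langle\mathcal S\rangle=\{G : G\subseteq F \text{ for some } F\in\mathcal S\}$. Fix an abelian group $\Gamma$ and a linear order on the set of vertices. An $i$-chain is a finite formal sum $c=\sum_F a_F F$ with $a_F\in\Gamma$, over sets $F$ of $i+1$ vertices; its support is $\operatorname{supp} c=\{F: a_F\neq 0\}$. Its boundary is $\partial c=\sum_F a_F\,\partial F$, where $\partial\{x_1<\dots<x_{i+1}\}=\sum_{j=1}^{i+1}(-1)^j\,(\{x_1,\dots,x_{i+1}\}\setminus\{x_j\})$, and $c$ is an $i$-cycle if $\partial c=0$. A subchain of $c$ is an $i$-chain $\sum_F b_F F$ with $b_F\in\{a_F,0\}$ for every $F$. An $i$-cycle $c$ is minimal if its only subchains that are $i$-cycles are $c$ and $0$. A $(d-1)$-dimensional simplicial complex $\Delta$ is a minimal $(d-1)$-cycle complex over $\Gamma$ if either $\Delta=\langle\{F\}\rangle$ for a set $F$ with $|F|=d$,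 or $\Delta=\langle \operatorname{supp} c\rangle$ for a nonzero minimal $(d-1)$-cycle $c$ with coefficients in $\Gamma$. A $(d-1)$-dimensional simplicial complex is balanced if its graph (its vertices and its $1$-dimensional faces) is $d$-colorable. Finally, let $f_i(\Delta)$ be the number of $i$-dimensional faces of $\Delta$ and, for a $(d-1)$-dimensional $\Delta$ and $0\le j\le d$, let $$h_j(\Delta)=\sum_{i=0}^{j}(-1)^{j-i}\binom{d-i}{d-j}f_{i-1}(\Delta).$$ Corollary 4.3. Let $d\ge 3$, let $\Gamma$ be an abelian group, and let $\Delta$ be a balanced minimal $(d-1)$-cycle complex over $\Gamma$. Then $$2h_2(\Delta)\ \ge\ (d-1)\,h_1(\Delta).$$ -/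

import Mathlib

open Finset

/-- A simplicial complex with vertices in `V`: a finite collection of finite sets (the faces,
the empty face included) that is closed under taking subsets. -/
@[ext]
structure FinSimplicialComplex (V : Type*) where
  /-- the faces -/
  faces : Finset (Finset V)
  /-- every subset of a face is a face -/
  down_closed : ∀ F ∈ faces, ∀ G : Finset V, G ⊆ F → G ∈ faces

/-- The dimension `|F| - 1` of a finite set `F` regarded as a face. -/
def faceDim {V : Type*} (F : Finset V) : ℤ := (#F : ℤ) - 1

namespace FinSimplicialComplex

/-- The largest number of vertices of a face, that is, the `d` for which the complex is
`(d - 1)`-dimensional. -/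
def maxCard {V : Type*} (Δ : FinSimplicialComplex V) : ℕ := Δ.faces.sup Finset.card

/-- The dimension of a complex: the maximal dimension of a face. -/
def dim {V : Type*} (Δ : FinSimplicialComplex V) : ℤ := (Δ.maxCard : ℤ) - 1

/-- `f_i(Δ)`: the number of faces of dimension `i` (where `i ≥ -1`). -/
def fNum {V : Type*} (Δ : FinSimplicialComplex V) (i : ℤ) : ℕ :=
  #{F ∈ Δ.faces | faceDim F = i}

/-- The entry `h_j(Δ) = ∑_{i=0}^{j} (-1)^{j-i} (d-i choose d-j) f_{i-1}(Δ)` of the `h`-vector of a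
`(d - 1)`-dimensional complex, for `0 ≤ j ≤ d`. -/
def hNum {V : Type*} (Δ : FinSimplicialComplex V) (j : ℕ) : ℤ :=
  ∑ i ∈ Finset.range (j + 1),
    (-1) ^ (j - i) * ((Δ.maxCard - i).choose (Δ.maxCard - j) : ℤ) * (Δ.fNum ((i : ℤ) - 1) : ℤ)

/-- The complex `⟨S⟩` spanned by a finite collection `S` of finite sets: all subsets of members
of `S`. -/
def spanned {V : Type*} [DecidableEq V] (S : Finset (Finset V)) : FinSimplicialComplex V where
  faces := S.biUnion Finset.powerset
  down_closed := by
    intro F hF G hG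
    rw [Finset.mem_biUnion] at hF ⊢
    obtain ⟨A, hA, hFA⟩ := hF
    exact ⟨A, hA, Finset.mem_powerset.2 (hG.trans (Finset.mem_powerset.1 hFA))⟩

/-- The vertex set `V(Δ)`: all `v` such that `{v}` is a face. -/
def vertexSet {V : Type*} (Δ : FinSimplicialComplex V) : Set V := {v | {v} ∈ Δ.faces}

/-- The graph (`1`-skeleton) `G(Δ)`, on the vertex set of `Δ`. -/
def graph {V : Type*} [DecidableEq V] (Δ : FinSimplicialComplex V) :
    SimpleGraph Δ.vertexSet where
  Adj u v := u ≠ v ∧ ({(u : V), (v : V)} : Finset V) ∈ Δ.faces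
  symm := ⟨fun _ _ h => ⟨h.1.symm, by rw [Finset.pair_comm]; exact h.2⟩⟩
  loopless := ⟨fun _ h => h.1 rfl⟩

/-- A `(d - 1)`-dimensional complex is balanced if its graph is `d`-colorable. -/
def IsBalanced {V : Type*} [DecidableEq V] (Δ : FinSimplicialComplex V) : Prop :=
  Δ.graph.Colorable Δ.maxCard

end FinSimplicialComplex

/-- The simplicial boundary of a chain with coefficients in `Γ`. It is additive, and for
`F = {x_1 < ⋯ < x_k}` it takes `a • F` to `∑_j (-1)^j a • (F \ {x_j})`; the position `j` of
`x = x_j` in `F` is the number of `y ∈ F` with `y ≤ x`. -/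
noncomputable def chainBoundary {V : Type*} [LinearOrder V] {Γ : Type*} [AddCommGroup Γ]
    (c : Finset V →₀ Γ) : Finset V →₀ Γ :=
  c.sum fun F a => ∑ x ∈ F, Finsupp.single (F.erase x) (((-1 : ℤ) ^ #{y ∈ F | y ≤ x}) • a)

/-- `c` is an `i`-chain: a formal sum of `i`-dimensional faces with coefficients in `Γ`. -/
def IsSimplicialChain {V : Type*} {Γ : Type*} [AddCommGroup Γ] (i : ℤ)
    (c : Finset V →₀ Γ) : Prop :=
  ∀ F ∈ c.support, faceDim F = i

/-- `c` is an `i`-cycle: an `i`-chain with zero boundary. -/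
def IsSimplicialCycle {V : Type*} [LinearOrder V] {Γ : Type*} [AddCommGroup Γ] (i : ℤ)
    (c : Finset V →₀ Γ) : Prop :=
  IsSimplicialChain i c ∧ chainBoundary c = 0

/-- `b` is a subchain of `c`: each coefficient of `b` is that of `c` or zero. -/
def IsSubchain {V : Type*} {Γ : Type*} [AddCommGroup Γ] (b c : Finset V →₀ Γ) : Prop :=
  ∀ F : Finset V, b F = c F ∨ b F = 0

/-- `c` is a minimal `i`-cycle: an `i`-cycle whose only subchains that are `i`-cycles are `c`
and `0`. -/
def IsMinimalCycle {V : Type*} [LinearOrder V] {Γ : Type*} [AddCommGroup Γ] (i : ℤ)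
    (c : Finset V →₀ Γ) : Prop :=
  IsSimplicialCycle i c ∧
    ∀ b : Finset V →₀ Γ, IsSimplicialCycle i b → IsSubchain b c → b = c ∨ b = 0

/-- `Δ` is a minimal `i`-cycle complex over the abelian group `Γ`: it is `i`-dimensional, and it is
spanned by a single set of dimension `i` or by the support of a nonzero minimal `i`-cycle. -/
def IsMinimalCycleComplex {V : Type*} [LinearOrder V] (Γ : Type*) [AddCommGroup Γ] (i : ℤ)
    (Δ : FinSimplicialComplex V) : Prop :=
  Δ.dim = i ∧
    ((∃ F : Finset V, faceDim F = i ∧ Δ = FinSimplicialComplex.spanned {F}) ∨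
      ∃ c : Finset V →₀ Γ, c ≠ 0 ∧ IsMinimalCycle i c ∧
        Δ = FinSimplicialComplex.spanned c.support)

/-!
The inequality is deduced from a rigidity theorem. Up to a positive factor it is the sum, over all
sets `T` of three colours, of the inequalities `3 f₀ ≤ f₁ + 6` for the subcomplexes `Δ_T` formed by
the vertices with colours in `T`. Such an inequality holds for every graph that is rigid in `ℝ³`
(`IsRigid.three_mul_card_le`). Here rigidity refers to Kalai's hyperconnectivity rather than to
bar-joint frameworks: a motion of `p : V → ℝ³` is a map `z` with `⟨z a, p b⟩ = ⟨z b, p a⟩` on all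
edges `ab`, and rigidity means that every motion is induced by a single linear map. This has two
advantages. Rigid families glue along triangles by comparing linear maps, and vertex splitting
(`eventually_isRigid_of_contract`) needs no limit argument: if `u` and `v` are placed at the same
point, the edge `uv` and two common neighbours force every motion to agree at `u` and `v`.

That minimal `2`-cycles are generically rigid (`eventually_isRigid_support`) is proved along the
lines of Fogelsanger, for an arbitrary coefficient group. Contracting an edge `uv` of a
minimal cycle gives a cycle, which splits into smaller minimal cycles. They are lifted back to
cycles by means of the chain homotopy `D` between the identity and the contraction (`prismHom`,
`fillHom`), and the lifts are rigid by vertex splitting. To see that the union of the lifts is rigid,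
label each triangle by the linear map that a given motion induces on it: the label classes of the
original cycle are sums of lifts, hence cycles, so minimality leaves only one class
(`boundaryHom_filter_eq_zero_of_sum`, `IsMinimalCycle.label_eq`).

The same labelling argument, applied to a minimal `(d - 1)`-cycle and to the triangles cut out of
its facets by the colours in `T`, shows that `Δ_T` is rigid
(`eventually_isRigid_image_colorPart`); here the links of the faces with the complementary
colours are `2`-cycles.
-/

/-! ### The boundary operator and minimal cycles -/

section Boundary

variable {V : Type*} [LinearOrder V] {Γ : Type*} [AddCommGroup Γ]

/-- The incidence number of `F` and `F.erase x`: the sign with which `F.erase x` occurs in the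
boundary of `F`. -/
def incSign (F : Finset V) (x : V) : ℤ := (-1) ^ #{y ∈ F | y ≤ x}

lemma incSign_mul_self (F : Finset V) (x : V) : incSign F x * incSign F x = 1 := by
  rw [incSign, ← mul_pow]; simp

lemma incSign_eq_or (F : Finset V) (x : V) : incSign F x = 1 ∨ incSign F x = -1 :=
  neg_one_pow_eq_or ℤ _

lemma incSign_smul_self (F : Finset V) (x : V) (a : Γ) :
    incSign F x • incSign F x • a = a := by
  rw [smul_smul, incSign_mul_self, one_smul]

lemma incSign_smul_eq_zero (F : Finset V) (x : V) {a : Γ} : incSign F x • a = 0 ↔ a = 0 := by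
  rcases incSign_eq_or F x with h | h <;> simp [h]

lemma incSign_eq_of_lt {F : Finset V} {x y : V} (hxy : x < y) :
    incSign (F.erase y) x = incSign F x := by
  unfold incSign
  congr 2
  ext w
  simp only [mem_filter, mem_erase]
  constructor
  · rintro ⟨⟨_, h⟩, h'⟩; exact ⟨h, h'⟩
  · rintro ⟨h, h'⟩; exact ⟨⟨(h'.trans_lt hxy).ne, h⟩, h'⟩

lemma incSign_eq_neg_of_lt {F : Finset V} {x y : V} (hx : x ∈ F) (hxy : x < y) :
    incSign (F.erase x) y = -incSign F y := by
  unfold incSign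
  have h : ({w ∈ F.erase x | w ≤ y} : Finset V) = ({w ∈ F | w ≤ y} : Finset V).erase x := by
    ext w; simp only [mem_filter, mem_erase]; tauto
  have hm : x ∈ ({w ∈ F | w ≤ y} : Finset V) := by simp [hx, hxy.le]
  rw [h, ← card_erase_add_one hm, pow_succ]
  simp

/-- The identity of incidence numbers behind `∂ ∘ ∂ = 0`: removing `x` and `y` in the two possible
orders produces opposite signs. -/
lemma incSign_mul_incSign_erase {F : Finset V} {x y : V} (hx : x ∈ F) (hy : y ∈ F) (hxy : x ≠ y) :
    incSign F x * incSign (F.erase x) y = -(incSign F y * incSign (F.erase y) x) := by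
  rcases lt_or_gt_of_ne hxy with h | h
  · rw [incSign_eq_neg_of_lt hx h, incSign_eq_of_lt h]; ring
  · rw [incSign_eq_neg_of_lt hy h, incSign_eq_of_lt h]; ring

/-- The simplicial boundary `chainBoundary` as a homomorphism. -/
noncomputable def boundaryHom : (Finset V →₀ Γ) →+ (Finset V →₀ Γ) :=
  Finsupp.liftAddHom fun F =>
    ∑ x ∈ F, (Finsupp.singleAddHom (F.erase x)).comp (zsmulAddGroupHom (incSign F x))

lemma boundaryHom_single (F : Finset V) (a : Γ) :
    boundaryHom (Finsupp.single F a) =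
      ∑ x ∈ F, Finsupp.single (F.erase x) (incSign F x • a) := by
  simp [boundaryHom]

lemma boundaryHom_apply (c : Finset V →₀ Γ) : boundaryHom c = chainBoundary c := by
  simp only [boundaryHom, Finsupp.liftAddHom_apply, chainBoundary]
  refine Finsupp.sum_congr fun F _ => ?_
  simp [incSign]

lemma boundaryHom_boundaryHom (c : Finset V →₀ Γ) : boundaryHom (boundaryHom c) = 0 := by
  suffices h : (boundaryHom (V := V) (Γ := Γ)).comp boundaryHom = 0 from DFunLike.congr_fun h c
  refine Finsupp.addHom_ext fun F a => ?_
  simp only [AddMonoidHom.comp_apply, boundaryHom_single, map_sum, AddMonoidHom.zero_apply,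
    Finset.sum_sigma']
  refine Finset.sum_involution (fun p _ => ⟨p.2, p.1⟩) ?_ ?_ ?_ ?_
  · rintro ⟨x, y⟩ h
    simp only [mem_sigma, mem_erase] at h
    obtain ⟨hx, hyx, hy⟩ := h
    simp only [smul_smul]
    rw [erase_right_comm, ← Finsupp.single_add, ← add_smul, mul_comm,
      incSign_mul_incSign_erase hx hy (Ne.symm hyx), mul_comm (incSign (F.erase y) x)]
    simp
  · rintro ⟨x, y⟩ h _ heq
    simp only [mem_sigma, mem_erase] at h
    simp only [Sigma.mk.injEq, heq_eq_eq] at heq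
    exact h.2.1 heq.1
  · rintro ⟨x, y⟩ h
    simp only [mem_sigma, mem_erase] at h ⊢
    exact ⟨h.2.2, Ne.symm h.2.1, h.1⟩
  · rintro ⟨x, y⟩ _; rfl

lemma boundaryHom_coeff (c : Finset V →₀ Γ) (G : Finset V) :
    boundaryHom c G = ∑ F ∈ c.support, ∑ x ∈ F, if F.erase x = G then incSign F x • c F else 0 := by
  conv_lhs => rw [← Finsupp.sum_single c]
  simp only [Finsupp.sum, map_sum, boundaryHom_single, Finsupp.finsetSum_apply,
    Finsupp.single_apply]

/-- The boundary at `G` only depends on the coefficients of the sets that arise from `G` by adding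
a vertex. -/
lemma boundaryHom_congr {b c : Finset V →₀ Γ} {G : Finset V}
    (h : ∀ F, ∀ x ∈ F, F.erase x = G → b F = c F) : boundaryHom b G = boundaryHom c G := by
  rw [← sub_eq_zero, ← Finsupp.sub_apply, ← map_sub, boundaryHom_coeff]
  refine Finset.sum_eq_zero fun F _ => Finset.sum_eq_zero fun x hx => ?_
  split_ifs with hG
  · rw [Finsupp.sub_apply, h F x hx hG, sub_self, smul_zero]
  · rfl

lemma exists_mem_support_of_boundaryHom_ne_zero {c : Finset V →₀ Γ} {G : Finset V}
    (h : boundaryHom c G ≠ 0) : ∃ F ∈ c.support, ∃ x ∈ F, F.erase x = G := by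
  by_contra! hn
  refine h ((boundaryHom_congr fun F x hx hG => ?_).trans (by rw [map_zero]; rfl))
  by_contra hF
  exact hn F (Finsupp.mem_support_iff.2 hF) x hx hG

/-- In a cycle every codimension one face lies in at least two faces of the support. -/
lemma exists_ne_mem_support_of_boundaryHom_eq_zero {c : Finset V →₀ Γ} (hc : boundaryHom c = 0)
    {F : Finset V} (hF : F ∈ c.support) {x : V} (hx : x ∈ F) :
    ∃ F' ∈ c.support, F' ≠ F ∧ ∃ y ∈ F', F'.erase y = F.erase x := by
  by_contra! hn
  have h : boundaryHom c (F.erase x) = boundaryHom (Finsupp.single F (c F)) (F.erase x) := by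
    refine boundaryHom_congr fun F' y hy hG => ?_
    by_cases hFF : F' = F
    · rw [hFF, Finsupp.single_eq_same]
    · rw [Finsupp.single_eq_of_ne hFF]
      by_contra h0
      exact hn F' (Finsupp.mem_support_iff.2 h0) hFF y hy hG
  rw [hc, boundaryHom_single, Finsupp.finsetSum_apply, sum_eq_single_of_mem x hx,
    Finsupp.single_eq_same] at h
  · exact (Finsupp.mem_support_iff.1 hF) ((incSign_smul_eq_zero _ _).1 h.symm)
  · intro y hy hyx
    refine Finsupp.single_eq_of_ne fun h' => hyx ?_
    by_contra h''
    exact notMem_erase y F (h' ▸ mem_erase.2 ⟨h'', hy⟩)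

/-! ### Contracting a vertex -/

/-- The image of a face under the simplicial map that sends `u` to `v` and fixes all other
vertices. -/
def contractFace (u v : V) (F : Finset V) : Finset V := if u ∈ F then insert v (F.erase u) else F

/-- The prism operator for the contraction of `u` to `v`: up to sign, it adds `v` to the faces that
contain `u`. -/
noncomputable def prismHom (u v : V) : (Finset V →₀ Γ) →+ (Finset V →₀ Γ) :=
  Finsupp.liftAddHom fun F =>
    if u ∈ F ∧ v ∉ F then
      (Finsupp.singleAddHom (insert v F)).comp (zsmulAddGroupHom (-incSign (insert v F) v))
    else 0

lemma prismHom_single_of_mem {u v : V} {F : Finset V} (hu : u ∈ F) (hv : v ∉ F) (a : Γ) :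
    prismHom u v (Finsupp.single F a) =
      Finsupp.single (insert v F) (-incSign (insert v F) v • a) := by
  simp [prismHom, hu, hv]

lemma prismHom_single_of_notMem {u v : V} {F : Finset V} (h : ¬(u ∈ F ∧ v ∉ F)) (a : Γ) :
    prismHom u v (Finsupp.single F a) = 0 := by
  rw [prismHom, Finsupp.liftAddHom_apply_single, if_neg h, AddMonoidHom.zero_apply]

/-- The chain map induced by the contraction of `u` to `v`. Defining it through the homotopy
`D` of `prismHom`, as `1 + D ∂ + ∂ D`, makes it commute with `∂` for free;
`contractHom_single` shows that it is the expected map up to signs. -/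
noncomputable def contractHom (u v : V) : (Finset V →₀ Γ) →+ (Finset V →₀ Γ) :=
  AddMonoidHom.id _ + (prismHom u v).comp boundaryHom + boundaryHom.comp (prismHom u v)

lemma contractHom_apply (u v : V) (c : Finset V →₀ Γ) :
    contractHom u v c = c + prismHom u v (boundaryHom c) + boundaryHom (prismHom u v c) := rfl

lemma contractHom_single_of_notMem {u v : V} {F : Finset V} (hu : u ∉ F) (a : Γ) :
    contractHom u v (Finsupp.single F a) = Finsupp.single F a := by
  rw [contractHom_apply, prismHom_single_of_notMem (fun h => hu h.1), boundaryHom_single, map_sum,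
    Finset.sum_eq_zero fun x _ => prismHom_single_of_notMem (fun h => hu (mem_of_mem_erase h.1)) _]
  simp

lemma contractHom_single_of_mem_of_mem {u v : V} {F : Finset V} (huv : u ≠ v) (hu : u ∈ F)
    (hv : v ∈ F) (a : Γ) : contractHom u v (Finsupp.single F a) = 0 := by
  rw [contractHom_apply, prismHom_single_of_notMem (fun h => h.2 hv), boundaryHom_single, map_sum,
    Finset.sum_eq_single_of_mem v hv, prismHom_single_of_mem (mem_erase.2 ⟨huv, hu⟩)
      (notMem_erase _ _), insert_erase hv, neg_smul, incSign_smul_self]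
  · simp
  · intro x hx hxv
    exact prismHom_single_of_notMem (fun h => h.2 (mem_erase.2 ⟨hxv.symm, hv⟩)) _

lemma contractHom_single_of_mem_of_notMem {u v : V} {F : Finset V} (hu : u ∈ F) (hv : v ∉ F)
    (a : Γ) : contractHom u v (Finsupp.single F a) =
      Finsupp.single (insert v (F.erase u))
        (-(incSign (insert v F) v * incSign (insert v F) u) • a) := by
  have huv : u ≠ v := fun h => hv (h ▸ hu)
  rw [contractHom_apply, prismHom_single_of_mem hu hv, boundaryHom_single, boundaryHom_single,
    sum_insert hv, erase_insert hv, ← add_sum_erase F _ hu, map_add, map_sum, ← add_sum_erase F _ hu,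
    prismHom_single_of_notMem (fun h => notMem_erase _ _ h.1)]
  have h1 : incSign (insert v F) v • -incSign (insert v F) v • a = -a := by
    rw [neg_smul, smul_neg, incSign_smul_self]
  have h2 : (insert v F).erase u = insert v (F.erase u) := erase_insert_of_ne huv.symm
  have h3 : ∀ x ∈ F.erase u,
      prismHom u v (Finsupp.single (F.erase x) (incSign F x • a)) =
        -Finsupp.single ((insert v F).erase x)
          (incSign (insert v F) x • -incSign (insert v F) v • a) := by
    intro x hx
    have hxF := mem_of_mem_erase hx
    have hxv : x ≠ v := fun h => hv (h ▸ hxF)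
    have key := incSign_mul_incSign_erase (mem_insert_self v F) (mem_insert_of_mem hxF) hxv.symm
    rw [erase_insert hv] at key
    rw [prismHom_single_of_mem (mem_erase.2 ⟨(mem_erase.1 hx).1.symm, hu⟩)
      (fun h => hv (mem_of_mem_erase h)), ← erase_insert_of_ne hxv.symm, ← Finsupp.single_neg]
    congr 1
    have e2 := incSign_mul_self (insert v F) v
    have e3 : incSign F x = -(incSign (insert v F) v * incSign (insert v F) x
        * incSign ((insert v F).erase x) v) := by
      linear_combination incSign (insert v F) v * key - incSign F x * e2
    have e4 := incSign_mul_self ((insert v F).erase x) v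
    simp only [smul_smul, ← neg_smul]
    congr 1
    rw [e3]
    linear_combination (incSign (insert v F) v * incSign (insert v F) x) * e4
  rw [sum_congr rfl h3, h1, h2, sum_neg_distrib, Finsupp.single_neg, smul_smul]
  rw [mul_neg, mul_comm (incSign (insert v F) u)]
  abel

lemma contractHom_single {u v : V} (huv : u ≠ v) (F : Finset V) :
    ∃ ε : ℤ, (ε = 1 ∨ ε = -1) ∧ ∀ a : Γ, contractHom u v (Finsupp.single F a) =
      if u ∈ F ∧ v ∈ F then 0 else Finsupp.single (contractFace u v F) (ε • a) := by
  by_cases hu : u ∈ F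
  · by_cases hv : v ∈ F
    · exact ⟨1, Or.inl rfl, fun a => by
        rw [if_pos ⟨hu, hv⟩, contractHom_single_of_mem_of_mem huv hu hv]⟩
    · refine ⟨_, ?_, fun a => by
        rw [if_neg fun h => hv h.2, contractFace, if_pos hu,
          contractHom_single_of_mem_of_notMem hu hv]⟩
      rcases incSign_eq_or (insert v F) v with h | h <;>
        rcases incSign_eq_or (insert v F) u with h' | h' <;> simp [h, h']
  · exact ⟨1, Or.inl rfl, fun a => by
      rw [if_neg fun h => hu h.1, contractFace, if_neg hu, contractHom_single_of_notMem hu,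
        one_smul]⟩

lemma exists_of_contractHom_ne_zero {u v : V} (huv : u ≠ v) {c : Finset V →₀ Γ} {G : Finset V}
    (h : contractHom u v c G ≠ 0) :
    ∃ F ∈ c.support, ¬(u ∈ F ∧ v ∈ F) ∧ contractFace u v F = G := by
  by_contra! hn
  apply h
  conv_lhs => rw [← Finsupp.sum_single c]
  rw [Finsupp.sum, map_sum, Finsupp.finsetSum_apply]
  refine sum_eq_zero fun F hF => ?_
  obtain ⟨ε, -, hε⟩ := contractHom_single (Γ := Γ) huv F
  rw [hε]
  split_ifs with h'
  · rfl
  · exact Finsupp.single_eq_of_ne (hn F hF fun h₁ h₂ => h' ⟨h₁, h₂⟩).symm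

/-- Contraction commutes with restricting a chain to the faces whose image satisfies `q`. The faces
that contain the contracted edge may be dropped, since they are mapped to zero. -/
lemma contractHom_filter {u v : V} (huv : u ≠ v) (q : Finset V → Prop) [DecidablePred q]
    (c : Finset V →₀ Γ) :
    contractHom u v (c.filter fun F => ¬(u ∈ F ∧ v ∈ F) ∧ q (contractFace u v F)) =
      (contractHom u v c).filter q := by
  induction c using Finsupp.induction_linear with
  | zero => rw [Finsupp.filter_zero, map_zero, Finsupp.filter_zero]
  | add f g hf hg => rw [Finsupp.filter_add, map_add, hf, hg, map_add, Finsupp.filter_add]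
  | single F a =>
    obtain ⟨ε, -, hε⟩ := contractHom_single (Γ := Γ) huv F
    by_cases hF : u ∈ F ∧ v ∈ F
    · rw [Finsupp.filter_single_of_neg _ (fun h => h.1 hF), hε, if_pos hF, map_zero,
        Finsupp.filter_zero]
    · by_cases hq : q (contractFace u v F)
      · rw [Finsupp.filter_single_of_pos
          (fun F => ¬(u ∈ F ∧ v ∈ F) ∧ q (contractFace u v F)) ⟨hF, hq⟩, hε, if_neg hF,
          Finsupp.filter_single_of_pos q hq]
      · rw [Finsupp.filter_single_of_neg _ (fun h => hq h.2), hε, if_neg hF,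
          Finsupp.filter_single_of_neg _ hq, map_zero]

/-- `b ↦ b + D ∂ b`: it adds to a chain `b` the faces through the edge `uv` that are needed to turn
`b` into a cycle when the contraction of `b` is one. -/
noncomputable def fillHom (u v : V) : (Finset V →₀ Γ) →+ (Finset V →₀ Γ) :=
  AddMonoidHom.id _ + (prismHom u v).comp boundaryHom

lemma fillHom_apply (u v : V) (c : Finset V →₀ Γ) :
    fillHom u v c = c + prismHom u v (boundaryHom c) := rfl

lemma boundaryHom_fillHom (u v : V) (c : Finset V →₀ Γ) :
    boundaryHom (fillHom u v c) = boundaryHom (contractHom u v c) := by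
  rw [fillHom_apply, contractHom_apply, map_add _ (c + _), boundaryHom_boundaryHom, add_zero]

lemma prismHom_apply_ne_zero {u v : V} {c : Finset V →₀ Γ} {G : Finset V}
    (h : prismHom u v c G ≠ 0) : u ∈ G ∧ v ∈ G ∧ c (G.erase v) ≠ 0 := by
  by_contra hn
  apply h
  conv_lhs => rw [← Finsupp.sum_single c]
  rw [Finsupp.sum, map_sum, Finsupp.finsetSum_apply]
  refine sum_eq_zero fun F hF => ?_
  by_cases hF' : u ∈ F ∧ v ∉ F
  · rw [prismHom_single_of_mem hF'.1 hF'.2]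
    refine Finsupp.single_eq_of_ne ?_
    rintro rfl
    refine hn ⟨mem_insert_of_mem hF'.1, mem_insert_self _ _, ?_⟩
    rw [erase_insert hF'.2]
    exact Finsupp.mem_support_iff.1 hF
  · rw [prismHom_single_of_notMem hF']; rfl

/-- A cycle is recovered from its faces that do not contain both `u` and `v`. -/
lemma fillHom_filter_eq_self {u v : V} (huv : u ≠ v) {c : Finset V →₀ Γ}
    (hc : boundaryHom c = 0) : fillHom u v (c.filter fun F => ¬(u ∈ F ∧ v ∈ F)) = c := by
  have h0 : fillHom u v (c.filter fun F => u ∈ F ∧ v ∈ F) = 0 := by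
    clear hc
    induction c using Finsupp.induction_linear with
    | zero => rw [Finsupp.filter_zero, map_zero]
    | add f g hf hg => rw [Finsupp.filter_add, map_add, hf, hg, add_zero]
    | single F a =>
      by_cases hF : u ∈ F ∧ v ∈ F
      · rw [Finsupp.filter_single_of_pos (fun F => u ∈ F ∧ v ∈ F) hF]
        have := contractHom_single_of_mem_of_mem huv hF.1 hF.2 a
        rwa [contractHom_apply, prismHom_single_of_notMem (fun h => h.2 hF.2), map_zero,
          add_zero] at this
      · rw [Finsupp.filter_single_of_neg (fun F => u ∈ F ∧ v ∈ F) hF, map_zero]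
  have h1 := congrArg (fillHom u v) (Finsupp.filter_add_filter_not c fun F => u ∈ F ∧ v ∈ F)
  rw [map_add, h0, zero_add] at h1
  rw [h1, fillHom_apply, hc, map_zero, add_zero]

/-! ### Minimal cycles -/

lemma isSimplicialCycle_iff {i : ℤ} {c : Finset V →₀ Γ} :
    IsSimplicialCycle i c ↔ (∀ F ∈ c.support, (#F : ℤ) = i + 1) ∧ boundaryHom c = 0 := by
  rw [boundaryHom_apply]
  unfold IsSimplicialCycle IsSimplicialChain faceDim
  simp only [sub_eq_iff_eq_add]

lemma isMinimalCycle_zero (i : ℤ) : IsMinimalCycle i (0 : Finset V →₀ Γ) := by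
  refine ⟨isSimplicialCycle_iff.2 ⟨by simp, map_zero _⟩, fun b _ h => Or.inl ?_⟩
  ext F
  rcases h F with h | h <;> exact h

omit [LinearOrder V] in
lemma IsSubchain.apply_eq_of_ne_zero {b c : Finset V →₀ Γ} (h : IsSubchain b c) {F : Finset V}
    (hF : b F ≠ 0) : b F = c F := (h F).resolve_right hF

omit [LinearOrder V] in
lemma isSubchain_filter (c : Finset V →₀ Γ) (q : Finset V → Prop) [DecidablePred q] :
    IsSubchain (c.filter q) c := by
  intro F
  rw [Finsupp.filter_apply]
  split_ifs
  · exact Or.inl rfl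
  · exact Or.inr rfl

open Classical in
/-- Every cycle is a sum of minimal cycles with disjoint supports. The decomposition is encoded
as a labelling of the faces: the parts are the restrictions to the faces with a given label. -/
lemma exists_label_isMinimalCycle {i : ℤ} {c : Finset V →₀ Γ} (hc : IsSimplicialCycle i c) :
    ∃ l : Finset V → ℕ, ∀ j, IsMinimalCycle i (c.filter (l · = j)) := by
  induction hn : #c.support using Nat.strong_induction_on generalizing c with
  | _ n ih =>
  by_cases hmin : IsMinimalCycle i c
  · refine ⟨fun _ => 0, fun j => ?_⟩
    by_cases hj : 0 = j
    · rwa [Finsupp.filter_eq_self_iff _ _ |>.2 fun _ _ => hj]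
    · rw [Finsupp.filter_eq_zero_iff _ _ |>.2 fun _ h => absurd h hj]
      exact isMinimalCycle_zero i
  obtain ⟨b, hb, hbc, hne, h0⟩ :
      ∃ b, IsSimplicialCycle i b ∧ IsSubchain b c ∧ b ≠ c ∧ b ≠ 0 := by
    by_contra! h
    exact hmin ⟨hc, fun b hb hbc => or_iff_not_imp_left.2 (h b hb hbc)⟩
  have hbs : ∀ F, b F ≠ 0 → b F = c F := fun F => hbc.apply_eq_of_ne_zero
  have hsub : ∀ F, b F ≠ 0 → (c - b) F = 0 := fun F hF => by
    rw [Finsupp.sub_apply, hbs F hF, sub_self]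
  have hsub' : ∀ F, b F = 0 → (c - b) F = c F := fun F hF => by
    rw [Finsupp.sub_apply, hF, sub_zero]
  have hb_supp : b.support ⊆ c.support := fun F hF => by
    rw [Finsupp.mem_support_iff] at hF ⊢
    rwa [← hbs F hF]
  have hd_supp : (c - b).support ⊆ c.support := fun F hF => by
    rw [Finsupp.mem_support_iff] at hF ⊢
    rwa [← hsub' F (by by_contra h; exact hF (hsub F h))]
  rw [isSimplicialCycle_iff] at hc hb
  have hd : IsSimplicialCycle i (c - b) := isSimplicialCycle_iff.2
    ⟨fun F hF => hc.1 F (hd_supp hF), by rw [map_sub, hc.2, hb.2, sub_zero]⟩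
  have hb_lt : #b.support < n := by
    rw [← hn]
    refine card_lt_card (hb_supp.ssubset_of_ne fun h => hne ?_)
    ext F
    by_cases hF : b F = 0
    · rw [hF, Finsupp.notMem_support_iff.1 (h ▸ Finsupp.notMem_support_iff.2 hF)]
    · exact hbs F hF
  have hd_lt : #(c - b).support < n := by
    rw [← hn]
    obtain ⟨F, hF⟩ := Finsupp.ne_iff.1 h0
    refine card_lt_card (hd_supp.ssubset_of_ne fun h => ?_)
    exact Finsupp.notMem_support_iff.2 (hsub F hF)
      (h ▸ hb_supp (Finsupp.mem_support_iff.2 hF))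
  obtain ⟨l₁, hl₁⟩ := ih _ hb_lt (isSimplicialCycle_iff.2 hb) rfl
  obtain ⟨l₂, hl₂⟩ := ih _ hd_lt hd rfl
  refine ⟨fun F => if b F = 0 then 2 * l₂ F + 1 else 2 * l₁ F, fun j => ?_⟩
  obtain ⟨k, rfl | rfl⟩ := Nat.even_or_odd' j
  · convert hl₁ k using 1
    ext F
    simp only [Finsupp.filter_apply]
    by_cases hF : b F = 0
    · simp only [hF, if_true, ite_self]
      exact if_neg (by omega)
    · simp only [if_neg hF]
      rw [← hbs F hF]
      exact if_congr (by omega) rfl rfl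
  · convert hl₂ k using 1
    ext F
    simp only [Finsupp.filter_apply]
    by_cases hF : b F = 0
    · simp only [hF, if_true, hsub' F hF]
      exact if_congr (by omega) rfl rfl
    · simp only [hF, if_false, hsub F hF, ite_self]
      exact if_neg (by omega)

open Classical in
/-- If a chain is a sum of cycles on each of whose supports a labelling is constant, then its
restriction to the faces of any given label is a cycle. -/
lemma boundaryHom_filter_eq_zero_of_sum {ι X : Type*} {I : Finset ι} {e : ι → Finset V →₀ Γ}
    (he : ∀ i ∈ I, boundaryHom (e i) = 0) {L : Finset V → X}
    (hL : ∀ i ∈ I, ∀ F ∈ (e i).support, ∀ F' ∈ (e i).support, L F = L F') (x : X) :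
    boundaryHom ((∑ i ∈ I, e i).filter (L · = x)) = 0 := by
  have h : (∑ i ∈ I, e i).filter (L · = x) =
      ∑ i ∈ I with ∃ F ∈ (e i).support, L F = x, e i := by
    ext F
    rw [Finsupp.filter_apply, Finsupp.finsetSum_apply, Finsupp.finsetSum_apply]
    split_ifs with hF
    · refine (sum_filter_of_ne fun i _ h0 => ?_).symm
      exact ⟨F, Finsupp.mem_support_iff.2 h0, hF⟩
    · refine (sum_eq_zero fun i hi => ?_).symm
      obtain ⟨hi, F', hF', hx⟩ := mem_filter.1 hi
      by_contra h0
      exact hF ((hL i hi F (Finsupp.mem_support_iff.2 h0) F' hF').trans hx)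
  rw [h, map_sum]
  exact sum_eq_zero fun i hi => he i (mem_filter.1 hi).1

open Classical in
/-- A labelling of the faces of a minimal cycle whose label classes are cycles is constant. -/
lemma IsMinimalCycle.label_eq {X : Type*} {i : ℤ} {c : Finset V →₀ Γ} (hc : IsMinimalCycle i c)
    {L : Finset V → X} (hL : ∀ x, boundaryHom (c.filter (L · = x)) = 0)
    {F F' : Finset V} (hF : F ∈ c.support) (hF' : F' ∈ c.support) : L F = L F' := by
  have hcyc := isSimplicialCycle_iff.1 hc.1
  have h := hc.2 (c.filter (L · = L F')) (isSimplicialCycle_iff.2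
    ⟨fun G hG => hcyc.1 G (Finsupp.support_filter (L · = L F') c ▸ hG |> mem_filter.1 |>.1), hL _⟩)
    (isSubchain_filter c _)
  rcases h with h | h
  · exact (Finsupp.filter_eq_self_iff _ _).1 h F (Finsupp.mem_support_iff.1 hF)
  · exact absurd ((Finsupp.filter_eq_zero_iff _ _).1 h F' rfl) (Finsupp.mem_support_iff.1 hF')

/-! ### Links -/

/-- The link operator at the vertex `s`, with the signs that make it anticommute with `∂`. -/
noncomputable def linkHom (s : V) : (Finset V →₀ Γ) →+ (Finset V →₀ Γ) :=
  Finsupp.liftAddHom fun F =>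
    if s ∈ F then (Finsupp.singleAddHom (F.erase s)).comp (zsmulAddGroupHom (incSign F s)) else 0

lemma linkHom_single (s : V) (F : Finset V) (a : Γ) : linkHom s (Finsupp.single F a) =
    if s ∈ F then Finsupp.single (F.erase s) (incSign F s • a) else 0 := by
  rw [linkHom, Finsupp.liftAddHom_apply_single]
  split_ifs <;> simp

lemma linkHom_apply (s : V) (c : Finset V →₀ Γ) (G : Finset V) : linkHom s c G =
    if s ∈ G then 0 else incSign (insert s G) s • c (insert s G) := by
  induction c using Finsupp.induction_linear with
  | zero => simp
  | add f g hf hg =>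
    rw [map_add, Finsupp.add_apply, hf, hg]
    split_ifs <;> simp
  | single F a =>
    rw [linkHom_single]
    by_cases hs : s ∈ F
    · rw [if_pos hs, Finsupp.single_apply]
      by_cases hG : s ∈ G
      · rw [if_pos hG, if_neg]
        rintro rfl
        exact notMem_erase _ _ hG
      · rw [if_neg hG]
        by_cases h : F = insert s G
        · subst h
          rw [erase_insert hG, if_pos rfl, Finsupp.single_eq_same]
        · rw [if_neg (fun h' => h (by rw [← h', insert_erase hs])),
            Finsupp.single_eq_of_ne (Ne.symm h), smul_zero]
    · rw [if_neg hs, Finsupp.single_eq_of_ne (fun h : insert s G = F =>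
        hs (h ▸ mem_insert_self _ _))]
      simp

lemma linkHom_boundaryHom (s : V) (c : Finset V →₀ Γ) :
    linkHom s (boundaryHom c) = -boundaryHom (linkHom s c) := by
  induction c using Finsupp.induction_linear with
  | zero => simp
  | add f g hf hg => rw [map_add, map_add, hf, hg, map_add, map_add, neg_add]
  | single F a =>
    rw [boundaryHom_single, linkHom_single, map_sum]
    simp only [linkHom_single]
    by_cases hs : s ∈ F
    · rw [if_pos hs, boundaryHom_single, ← add_sum_erase F _ hs, if_neg (notMem_erase _ _),
        zero_add, ← sum_neg_distrib]
      refine sum_congr rfl fun x hx => ?_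
      obtain ⟨hxs, hx⟩ := mem_erase.1 hx
      rw [if_pos (mem_erase.2 ⟨hxs.symm, hs⟩), erase_right_comm, ← Finsupp.single_neg, smul_smul,
        smul_smul, ← neg_smul, mul_comm, incSign_mul_incSign_erase hx hs hxs, mul_comm (incSign F s)]
    · rw [if_neg hs, map_zero, neg_zero]
      exact sum_eq_zero fun x _ => if_neg fun h => hs (mem_of_mem_erase h)

/-- The link operator at a finite sequence of vertices. -/
noncomputable def linkListHom : List V → (Finset V →₀ Γ) →+ (Finset V →₀ Γ)
  | [] => AddMonoidHom.id _
  | s :: l => (linkListHom l).comp (linkHom s)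

lemma linkListHom_boundaryHom (l : List V) (c : Finset V →₀ Γ) :
    linkListHom l (boundaryHom c) = boundaryHom (linkListHom l c) ∨
      linkListHom l (boundaryHom c) = -boundaryHom (linkListHom l c) := by
  induction l generalizing c with
  | nil => exact Or.inl rfl
  | cons s l ih =>
    simp only [linkListHom, AddMonoidHom.comp_apply, linkHom_boundaryHom, map_neg]
    rcases ih (linkHom s c) with h | h <;> simp [h]

/-- Up to a sign that does not depend on the chain, the link at the vertices of `l` reads off the
coefficients of the faces that contain these vertices. -/
lemma linkListHom_apply {l : List V} (hl : l.Nodup) (G : Finset V) :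
    ∃ ε : ℤ, (ε = 1 ∨ ε = -1) ∧ ∀ c : Finset V →₀ Γ,
      linkListHom l c G = if Disjoint G l.toFinset then ε • c (G ∪ l.toFinset) else 0 := by
  induction l with
  | nil => exact ⟨1, Or.inl rfl, fun c => by simp [linkListHom]⟩
  | cons s l ih =>
    obtain ⟨hs, hl⟩ := List.nodup_cons.1 hl
    obtain ⟨ε, hε, h⟩ := ih hl
    refine ⟨ε * incSign (insert s (G ∪ l.toFinset)) s, ?_, fun c => ?_⟩
    · rcases hε with rfl | rfl <;>
        rcases incSign_eq_or (insert s (G ∪ l.toFinset)) s with h' | h' <;> simp [h']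
    · simp only [linkListHom, AddMonoidHom.comp_apply, h, linkHom_apply, List.toFinset_cons,
        disjoint_insert_right]
      by_cases hd : Disjoint G l.toFinset
      · by_cases hsG : s ∈ G
        · simp [hsG]
        · rw [if_pos hd, if_neg (by simp [hsG, hs]), if_pos ⟨hsG, hd⟩, smul_smul, union_insert]
      · rw [if_neg hd, if_neg fun h => hd h.2]

end Boundary

/-! ### Generic placements -/

section Rigidity

open Filter Matrix

variable {V : Type*}

/-- The filter of generic placements of `V` in `ℝ³`: a property holds eventually if it holds outside
the zero set of some nonzero polynomial in the coordinates. -/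
def genericFilter (V : Type*) : Filter (V → Fin 3 → ℝ) where
  sets := {S | ∃ Q : MvPolynomial (V × Fin 3) ℝ, Q ≠ 0 ∧
    ∀ p : V → Fin 3 → ℝ, Q.eval (fun i => p i.1 i.2) ≠ 0 → p ∈ S}
  univ_sets := ⟨1, one_ne_zero, fun _ _ => Set.mem_univ _⟩
  sets_of_superset := fun ⟨Q, hQ, h⟩ hST => ⟨Q, hQ, fun p hp => hST (h p hp)⟩
  inter_sets := fun ⟨Q, hQ, h⟩ ⟨Q', hQ', h'⟩ => ⟨Q * Q', mul_ne_zero hQ hQ', fun p hp => by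
    rw [map_mul] at hp
    exact ⟨h p (left_ne_zero_of_mul hp), h' p (right_ne_zero_of_mul hp)⟩⟩

lemma eventually_genericFilter_iff {P : (V → Fin 3 → ℝ) → Prop} :
    (∀ᶠ p in genericFilter V, P p) ↔ ∃ Q : MvPolynomial (V × Fin 3) ℝ, Q ≠ 0 ∧
      ∀ p : V → Fin 3 → ℝ, Q.eval (fun i => p i.1 i.2) ≠ 0 → P p := Iff.rfl

instance : (genericFilter V).NeBot := by
  rw [Filter.neBot_iff, Ne, ← Filter.empty_mem_iff_bot]
  rintro ⟨Q, hQ, h⟩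
  exact hQ (MvPolynomial.funext fun x => by
    by_contra hx
    exact h (fun a j => x (a, j)) (by simpa using hx))

/-- Injectivity of a matrix with polynomial entries at a single point propagates to all points
outside the zero set of a polynomial, namely of the Gram determinant. -/
lemma exists_polynomial_mulVec_injective {σ m n : Type*} [Fintype m] [Fintype n]
    [DecidableEq n] (M : Matrix m n (MvPolynomial σ ℝ)) (q : σ → ℝ)
    (hq : ∀ y, (M.map (MvPolynomial.eval q)) *ᵥ y = 0 → y = 0) :
    ∃ Q : MvPolynomial σ ℝ, Q ≠ 0 ∧ ∀ p : σ → ℝ, Q.eval p ≠ 0 →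
      ∀ y, (M.map (MvPolynomial.eval p)) *ᵥ y = 0 → y = 0 := by
  have hdet : ∀ p : σ → ℝ, MvPolynomial.eval p (Mᵀ * M).det =
      ((M.map (MvPolynomial.eval p))ᵀ * M.map (MvPolynomial.eval p)).det := by
    intro p
    rw [RingHom.map_det, RingHom.mapMatrix_apply, Matrix.map_mul, Matrix.transpose_map]
  refine ⟨(Mᵀ * M).det, fun h0 => ?_, fun p hp y hy => ?_⟩
  · have h := hdet q
    rw [h0, map_zero] at h
    obtain ⟨y, hy0, hy⟩ := Matrix.exists_mulVec_eq_zero_iff.2 h.symm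
    refine hy0 (hq y ?_)
    have : y ∈ LinearMap.ker ((M.map (MvPolynomial.eval q))ᵀ *
        M.map (MvPolynomial.eval q)).mulVecLin := hy
    rwa [Matrix.ker_mulVecLin_transpose_mul_self] at this
  · rw [hdet] at hp
    by_contra hy0
    refine hp (Matrix.exists_mulVec_eq_zero_iff.1 ⟨y, hy0, ?_⟩)
    rw [← Matrix.mulVec_mulVec, hy, Matrix.mulVec_zero]

lemma eventually_linearIndependent {T : Finset V} (hT : #T = 3) :
    ∀ᶠ p in genericFilter V, LinearIndependent ℝ fun a : T => p a := by
  classical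
  let e : Fin 3 ≃ T := (T.equivFinOfCardEq hT).symm
  let M : Matrix (Fin 3) (Fin 3) (MvPolynomial (V × Fin 3) ℝ) :=
    Matrix.of fun i j => MvPolynomial.X ((e i : V), j)
  have hdet : ∀ p : V → Fin 3 → ℝ, MvPolynomial.eval (fun i => p i.1 i.2) M.det =
      (Matrix.of fun i => p (e i)).det := by
    intro p
    rw [RingHom.map_det]
    congr 1
    ext i j
    simp [M]
  refine eventually_genericFilter_iff.2 ⟨M.det, fun h0 => ?_, fun p hp => ?_⟩
  · have h := hdet fun a => if h : a ∈ T then Pi.single (e.symm ⟨a, h⟩) 1 else 0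
    rw [h0, map_zero] at h
    have h1 : (Matrix.of fun i => (fun a => if h : a ∈ T then
        (Pi.single (e.symm ⟨a, h⟩) 1 : Fin 3 → ℝ) else 0) (e i : V)) = 1 := by
      ext i j
      simp [Matrix.one_apply, Pi.single_apply, eq_comm]
    rw [h1, Matrix.det_one] at h
    exact zero_ne_one h
  · rw [hdet] at hp
    have h := Matrix.linearIndependent_rows_iff_isUnit.2
      ((Matrix.isUnit_iff_isUnit_det _).2 (isUnit_iff_ne_zero.2 hp))
    exact (linearIndependent_equiv e).1 h

lemma span_range_eq_top {p : V → Fin 3 → ℝ} {T : Finset V} (hT : #T = 3)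
    (hp : LinearIndependent ℝ fun a : T => p a) :
    Submodule.span ℝ (Set.range fun a : T => p a) = ⊤ :=
  hp.span_eq_top_of_card_eq_finrank' (by simp [hT])

lemma linearMap_eq_of_eqOn {p : V → Fin 3 → ℝ} {T : Finset V} (hT : #T = 3)
    (hp : LinearIndependent ℝ fun a : T => p a) {A B : (Fin 3 → ℝ) →ₗ[ℝ] (Fin 3 → ℝ)}
    (h : ∀ a ∈ T, A (p a) = B (p a)) : A = B := by
  refine LinearMap.ext_on_range (span_range_eq_top hT hp) fun a => h a a.2

lemma eq_zero_of_forall_dotProduct {p : V → Fin 3 → ℝ} {T : Finset V} (hT : #T = 3)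
    (hp : LinearIndependent ℝ fun a : T => p a) {d : Fin 3 → ℝ} (h : ∀ a ∈ T, d ⬝ᵥ p a = 0) :
    d = 0 := by
  have h' : dotProductBilin ℝ ℝ d = 0 :=
    LinearMap.ext_on_range (span_range_eq_top hT hp) fun a => by simpa using h a a.2
  exact dotProduct_self_eq_zero.1 (by simpa using LinearMap.congr_fun h' d)

lemma exists_linearMap_eqOn {p : V → Fin 3 → ℝ} {T : Finset V} (hT : #T = 3)
    (hp : LinearIndependent ℝ fun a : T => p a) (z : V → Fin 3 → ℝ) :
    ∃ A : (Fin 3 → ℝ) →ₗ[ℝ] (Fin 3 → ℝ), ∀ a ∈ T, z a = A (p a) := by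
  let b := Module.Basis.mk hp (span_range_eq_top hT hp).ge
  refine ⟨b.constr ℝ fun a => z a, fun a ha => ?_⟩
  have h := b.constr_basis ℝ (fun a : T => z a) ⟨a, ha⟩
  rw [Module.Basis.mk_apply] at h
  exact h.symm

/-! ### Rigidity of families of triangles -/

/-- `z` is a motion of the family `𝓕` placed by `p` if `⟨z a, p b⟩ = ⟨z b, p a⟩` whenever `a` and
`b` lie in a common member of `𝓕`. This is the infinitesimal condition of Kalai's
hyperconnectivity, with a sign chosen so that its trivial solutions are `z = A ∘ p` for symmetric
`A`. -/
def IsMotion (p : V → Fin 3 → ℝ) (𝓕 : Finset (Finset V)) (z : V → Fin 3 → ℝ) : Prop :=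
  ∀ F ∈ 𝓕, ∀ a ∈ F, ∀ b ∈ F, z a ⬝ᵥ p b = z b ⬝ᵥ p a

/-- The family `𝓕` is rigid at the placement `p` if every motion is induced by one linear map on
all vertices of `𝓕`. (The linear map is then symmetric as soon as some member of `𝓕` is placed at
a basis, so there is no need to ask for it.) -/
def IsRigid (p : V → Fin 3 → ℝ) (𝓕 : Finset (Finset V)) : Prop :=
  ∀ z, IsMotion p 𝓕 z →
    ∃ A : (Fin 3 → ℝ) →ₗ[ℝ] (Fin 3 → ℝ), ∀ F ∈ 𝓕, ∀ a ∈ F, z a = A (p a)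

lemma IsMotion.mono {p z : V → Fin 3 → ℝ} {𝓕 𝓖 : Finset (Finset V)} (h : IsMotion p 𝓖 z)
    (h𝓕 : ∀ F ∈ 𝓕, ∀ a ∈ F, ∀ b ∈ F, a ≠ b → ∃ G ∈ 𝓖, a ∈ G ∧ b ∈ G) : IsMotion p 𝓕 z := by
  intro F hF a ha b hb
  by_cases hab : a = b
  · rw [hab]
  · obtain ⟨G, hG, haG, hbG⟩ := h𝓕 F hF a ha b hb hab
    exact h G hG a haG b hbG

lemma isRigid_singleton {p : V → Fin 3 → ℝ} {T : Finset V} (hT : #T = 3)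
    (hp : LinearIndependent ℝ fun a : T => p a) : IsRigid p {T} := by
  intro z _
  obtain ⟨A, hA⟩ := exists_linearMap_eqOn hT hp z
  exact ⟨A, fun F hF => by rw [mem_singleton.1 hF]; exact hA⟩

variable [DecidableEq V]

/-- The vertices of a family of sets. -/
abbrev familyVerts (𝓕 : Finset (Finset V)) : Finset V := 𝓕.biUnion id

/-- The edges of a family of sets: the pairs inside its members. -/
abbrev familyEdges (𝓕 : Finset (Finset V)) : Finset (Finset V) :=
  𝓕.biUnion (powersetCard 2)

/-- In a rigid family, a motion that vanishes on a triangle in general position vanishes. -/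
lemma IsRigid.eq_zero {p : V → Fin 3 → ℝ} {𝓕 : Finset (Finset V)} (h : IsRigid p 𝓕)
    {T : Finset V} (hT𝓕 : T ∈ 𝓕) (hT : #T = 3) (hp : LinearIndependent ℝ fun a : T => p a)
    {z : V → Fin 3 → ℝ} (hz : IsMotion p 𝓕 z) (h0 : ∀ a ∈ T, z a = 0) {a : V}
    (ha : a ∈ familyVerts 𝓕) : z a = 0 := by
  obtain ⟨A, hA⟩ := h z hz
  have hA0 : A = 0 := linearMap_eq_of_eqOn hT hp fun b hb => by
    rw [← hA T hT𝓕 b hb, h0 b hb, LinearMap.zero_apply]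
  obtain ⟨F, hF, haF⟩ := mem_biUnion.1 ha
  rw [hA F hF a haF, hA0, LinearMap.zero_apply]

/-- The converse of `IsRigid.eq_zero`: subtracting a suitable linear map makes any motion vanish
on a given triangle. -/
lemma isRigid_of_eq_zero {p : V → Fin 3 → ℝ} {𝓕 : Finset (Finset V)} {T : Finset V} (hT𝓕 : T ∈ 𝓕)
    (hT : #T = 3) (hp : LinearIndependent ℝ fun a : T => p a)
    (h : ∀ z, IsMotion p 𝓕 z → (∀ a ∈ T, z a = 0) → ∀ a ∈ familyVerts 𝓕, z a = 0) :
    IsRigid p 𝓕 := by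
  intro z hz
  obtain ⟨A, hA⟩ := exists_linearMap_eqOn hT hp z
  -- `A` is symmetric because `z` is a motion of the triangle `T`
  have hsymm : ∀ x y, A x ⬝ᵥ y = A y ⬝ᵥ x := by
    have h1 : ∀ a ∈ T, ∀ y, A (p a) ⬝ᵥ y = A y ⬝ᵥ p a := by
      intro a ha
      have : dotProductBilin ℝ ℝ (A (p a)) = (dotProductBilin ℝ ℝ (p a)).comp A :=
        LinearMap.ext_on_range (span_range_eq_top hT hp) fun b => by
          simp only [dotProductBilin_apply_apply, LinearMap.comp_apply]
          rw [← hA a ha, ← hA b b.2, hz T hT𝓕 a ha b b.2, dotProduct_comm]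
      intro y
      have := LinearMap.congr_fun this y
      simp only [dotProductBilin_apply_apply, LinearMap.comp_apply] at this
      rw [this, dotProduct_comm]
    intro x y
    have : (dotProductBilin ℝ ℝ y).comp A = dotProductBilin ℝ ℝ (A y) :=
      LinearMap.ext_on_range (span_range_eq_top hT hp) fun b => by
        simp only [dotProductBilin_apply_apply, LinearMap.comp_apply]
        rw [dotProduct_comm, h1 b b.2]
    have := LinearMap.congr_fun this x
    simp only [dotProductBilin_apply_apply, LinearMap.comp_apply] at this
    rw [dotProduct_comm, this]
  refine ⟨A, fun F hF a ha => ?_⟩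
  refine sub_eq_zero.1 (h (fun b => z b - A (p b)) ?_ (fun b hb => sub_eq_zero.2 (hA b hb)) a
    (mem_biUnion.2 ⟨F, hF, ha⟩))
  intro F hF a ha b hb
  rw [sub_dotProduct, sub_dotProduct, hz F hF a ha b hb, hsymm]

/-- The extension by zero of a function on `U`. -/
def extendZero (U : Finset V) (y : U × Fin 3 → ℝ) (a : V) : Fin 3 → ℝ :=
  if h : a ∈ U then fun j => y (⟨a, h⟩, j) else 0

lemma extendZero_dotProduct (U : Finset V) (y : U × Fin 3 → ℝ) (a : V) (w : Fin 3 → ℝ) :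
    extendZero U y a ⬝ᵥ w = ∑ i : U × Fin 3, (if (i.1 : V) = a then w i.2 else 0) * y i := by
  rw [Fintype.sum_prod_type]
  by_cases h : a ∈ U
  · rw [sum_eq_single (⟨a, h⟩ : U)]
    · simp [extendZero, h, dotProduct, mul_comm]
    · intro b _ hb
      have : (b : V) ≠ a := fun h' => hb (Subtype.ext h')
      simp [this]
    · simp
  · rw [extendZero, dif_neg h, zero_dotProduct, eq_comm]
    refine sum_eq_zero fun b _ => ?_
    have : (b : V) ≠ a := fun h' => h (h' ▸ b.2)
    simp [this]

/-- Rigidity at one placement, with some triangle in general position, implies rigidity at generic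
placements. -/
lemma IsRigid.eventually {q : V → Fin 3 → ℝ} {𝓕 : Finset (Finset V)} (h : IsRigid q 𝓕)
    {T : Finset V} (hT𝓕 : T ∈ 𝓕) (hT : #T = 3) (hq : LinearIndependent ℝ fun a : T => q a) :
    ∀ᶠ p in genericFilter V, IsRigid p 𝓕 := by
  classical
  set W := familyVerts 𝓕 with hW
  set U := W \ T with hU
  -- the linear system for the motions that vanish on `T`
  let M : Matrix (W × W) (U × Fin 3) (MvPolynomial (V × Fin 3) ℝ) := Matrix.of fun e i =>
    if ∃ F ∈ 𝓕, (e.1 : V) ∈ F ∧ (e.2 : V) ∈ F then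
      (if (i.1 : V) = e.1 then MvPolynomial.X ((e.2 : V), i.2) else 0) -
        (if (i.1 : V) = e.2 then MvPolynomial.X ((e.1 : V), i.2) else 0)
    else 0
  have hM : ∀ (p : V → Fin 3 → ℝ) (y : U × Fin 3 → ℝ) (e : W × W),
      (M.map (MvPolynomial.eval fun i => p i.1 i.2) *ᵥ y) e =
        if ∃ F ∈ 𝓕, (e.1 : V) ∈ F ∧ (e.2 : V) ∈ F then
          extendZero U y e.1 ⬝ᵥ p e.2 - extendZero U y e.2 ⬝ᵥ p e.1 else 0 := by
    intro p y e
    by_cases he : ∃ F ∈ 𝓕, (e.1 : V) ∈ F ∧ (e.2 : V) ∈ F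
    · simp only [mulVec, dotProduct, M, Matrix.map_apply, Matrix.of_apply, if_pos he, map_sub,
        apply_ite (MvPolynomial.eval _), MvPolynomial.eval_X, map_zero, sub_mul, sum_sub_distrib]
      rw [← extendZero_dotProduct U y e.1 (p e.2), ← extendZero_dotProduct U y e.2 (p e.1)]
      rfl
    · simp only [mulVec, dotProduct, M, Matrix.map_apply, Matrix.of_apply, if_neg he, map_zero,
        zero_mul, sum_const_zero]
  have hmem : ∀ {F a}, F ∈ 𝓕 → a ∈ F → a ∈ W := fun hF ha => mem_biUnion.2 ⟨_, hF, ha⟩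
  obtain ⟨Q, hQ0, hQ⟩ := exists_polynomial_mulVec_injective M (fun i => q i.1 i.2) (by
    intro y hy
    have hmot : IsMotion q 𝓕 (extendZero U y) := by
      intro F hF a ha b hb
      have := congrFun hy (⟨a, hmem hF ha⟩, ⟨b, hmem hF hb⟩)
      rw [hM, if_pos ⟨F, hF, ha, hb⟩] at this
      exact sub_eq_zero.1 this
    ext ⟨⟨a, ha⟩, j⟩
    have := h.eq_zero hT𝓕 hT hq hmot
      (fun b hb => dif_neg fun hbU => (Finset.mem_sdiff.1 hbU).2 hb) (Finset.mem_sdiff.1 ha).1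
    rw [extendZero, dif_pos ha] at this
    exact congrFun this j)
  filter_upwards [eventually_genericFilter_iff.2 ⟨Q, hQ0, fun p => hQ _⟩,
    eventually_linearIndependent hT] with p hp hpT
  refine isRigid_of_eq_zero hT𝓕 hT hpT fun z hz hz0 a ha => ?_
  by_cases haT : a ∈ T
  · exact hz0 a haT
  have haU : a ∈ U := Finset.mem_sdiff.2 ⟨ha, haT⟩
  have hext : ∀ b ∈ W, extendZero U (fun i => z i.1 i.2) b = z b := by
    intro b hb
    by_cases hbT : b ∈ T
    · rw [hz0 b hbT, extendZero, dif_neg fun hbU => (Finset.mem_sdiff.1 hbU).2 hbT]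
    · rw [extendZero, dif_pos (Finset.mem_sdiff.2 ⟨hb, hbT⟩)]
  have hy := hp (fun i => z i.1 i.2) (by
    ext ⟨b, c⟩
    rw [hM, hext b b.2, hext c c.2]
    split_ifs with hbc
    · obtain ⟨F, hF, hb, hc⟩ := hbc
      exact sub_eq_zero.2 (hz F hF b hb c hc)
    · rfl)
  ext j
  exact congrFun hy (⟨a, haU⟩, j)

/-- The lower bound on the number of edges of a rigid family. -/
lemma IsRigid.three_mul_card_le {p : V → Fin 3 → ℝ} {𝓕 : Finset (Finset V)} (h : IsRigid p 𝓕)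
    {T : Finset V} (hT𝓕 : T ∈ 𝓕) (hT : #T = 3) (hp : LinearIndependent ℝ fun a : T => p a) :
    3 * #(familyVerts 𝓕) ≤ #(familyEdges 𝓕) + 6 := by
  classical
  set W := familyVerts 𝓕 with hW
  set U := W \ T with hU
  -- the edges inside `T` impose no condition on the motions that vanish on `T`
  set E := familyEdges 𝓕 \ powersetCard 2 T with hE
  have hends : ∀ e : E, ∃ a b, a ≠ b ∧ (e : Finset V) = {a, b} := by
    rintro ⟨e, he⟩
    obtain ⟨F, -, hF⟩ := mem_biUnion.1 (Finset.mem_sdiff.1 he).1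
    exact card_eq_two.1 (mem_powersetCard.1 hF).2
  choose s t hst hends using hends
  let φ : (U × Fin 3 → ℝ) →ₗ[ℝ] (E → ℝ) :=
    { toFun := fun y e => extendZero U y (s e) ⬝ᵥ p (t e) - extendZero U y (t e) ⬝ᵥ p (s e)
      map_add' := by
        intro x y
        ext e
        simp only [extendZero_dotProduct, Pi.add_apply, mul_add, sum_add_distrib]
        ring
      map_smul' := by
        intro r y
        ext e
        simp only [extendZero_dotProduct, Pi.smul_apply, smul_eq_mul, RingHom.id_apply,
          mul_left_comm _ r, ← mul_sum]
        ring }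
  have hinj : Function.Injective φ := by
    rw [← LinearMap.ker_eq_bot, LinearMap.ker_eq_bot']
    intro y hy
    have hzT : ∀ b ∈ T, extendZero U y b = 0 :=
      fun b hb => dif_neg fun hbU => (Finset.mem_sdiff.1 hbU).2 hb
    have hmot : IsMotion p 𝓕 (extendZero U y) := by
      intro F hF a ha b hb
      by_cases hab : a = b
      · rw [hab]
      by_cases hT' : ({a, b} : Finset V) ∈ powersetCard 2 T
      · have hs := (mem_powersetCard.1 hT').1
        rw [hzT a (hs (by simp)), hzT b (hs (by simp)), zero_dotProduct, zero_dotProduct]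
      have he : ({a, b} : Finset V) ∈ E := by
        refine Finset.mem_sdiff.2 ⟨mem_biUnion.2 ⟨F, hF, mem_powersetCard.2 ⟨?_, card_pair hab⟩⟩, hT'⟩
        intro x hx
        rcases mem_insert.1 hx with rfl | hx
        · exact ha
        · rwa [mem_singleton.1 hx]
      have hφ : extendZero U y (s ⟨_, he⟩) ⬝ᵥ p (t ⟨_, he⟩) -
          extendZero U y (t ⟨_, he⟩) ⬝ᵥ p (s ⟨_, he⟩) = 0 := congrFun hy ⟨_, he⟩
      have hpair := hends ⟨_, he⟩
      have hne := hst ⟨_, he⟩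
      generalize s ⟨_, he⟩ = s₀ at *
      generalize t ⟨_, he⟩ = t₀ at *
      have hs : s₀ ∈ ({a, b} : Finset V) := by
        rw [show ({a, b} : Finset V) = {s₀, t₀} from hpair]; simp
      have ht : t₀ ∈ ({a, b} : Finset V) := by
        rw [show ({a, b} : Finset V) = {s₀, t₀} from hpair]; simp
      simp only [mem_insert, mem_singleton] at hs ht
      rcases hs with rfl | rfl <;> rcases ht with rfl | rfl
      · exact absurd rfl hne
      · exact sub_eq_zero.1 hφ
      · exact (sub_eq_zero.1 hφ).symm
      · exact absurd rfl hne
    ext ⟨⟨a, ha⟩, j⟩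
    have := h.eq_zero hT𝓕 hT hp hmot hzT (Finset.mem_sdiff.1 ha).1
    rw [extendZero, dif_pos ha] at this
    exact congrFun this j
  have hle := LinearMap.finrank_le_finrank_of_injective hinj
  simp only [Module.finrank_fintype_fun_eq_card, Fintype.card_prod, Fintype.card_coe,
    Fintype.card_fin] at hle
  have hUc : #U = #W - 3 := by
    have hTW : T ⊆ W := fun a ha => mem_biUnion.2 ⟨T, hT𝓕, ha⟩
    rw [hU, card_sdiff_of_subset hTW, hT]
  have hEc : #E = #(familyEdges 𝓕) - 3 := by
    have hTE : powersetCard 2 T ⊆ familyEdges 𝓕 := fun e he => mem_biUnion.2 ⟨T, hT𝓕, he⟩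
    rw [hE, card_sdiff_of_subset hTE, card_powersetCard, hT]
    rfl
  have hE3 : 3 ≤ #(familyEdges 𝓕) := by
    have := card_le_card (fun e he => mem_biUnion.2 ⟨T, hT𝓕, he⟩ :
      powersetCard 2 T ⊆ familyEdges 𝓕)
    rw [card_powersetCard, hT] at this
    exact this
  omega

end Rigidity

/-! ### Vertex splitting -/

section VertexSplit

open Matrix

variable {V : Type*} [LinearOrder V]

lemma mem_contractFace {u v : V} {F : Finset V} {a : V} (ha : a ∈ F) :
    (if a = u then v else a) ∈ contractFace u v F := by
  unfold contractFace
  split_ifs with h1 h2 h2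
  · exact mem_insert_self _ _
  · exact mem_insert_of_mem (mem_erase.2 ⟨h2, ha⟩)
  · exact absurd (h2 ▸ ha) h1
  · exact ha

lemma exists_mem_of_mem_contractFace {u v : V} {F : Finset V} {b : V}
    (hb : b ∈ contractFace u v F) : ∃ a ∈ F, (if a = u then v else a) = b := by
  unfold contractFace at hb
  split_ifs at hb with h
  · rcases mem_insert.1 hb with rfl | hb
    · exact ⟨u, h, if_pos rfl⟩
    · exact ⟨b, mem_of_mem_erase hb, if_neg (ne_of_mem_erase hb)⟩
  · exact ⟨b, hb, if_neg fun h' : b = u => h (h' ▸ hb)⟩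

lemma card_contractFace {u v : V} {F : Finset V} (h : ¬(u ∈ F ∧ v ∈ F)) :
    #(contractFace u v F) = #F := by
  unfold contractFace
  split_ifs with hu
  · rw [card_insert_of_notMem fun hv => h ⟨hu, mem_of_mem_erase hv⟩, card_erase_add_one hu]
  · rfl

/-- **Vertex splitting.** If the edge `uv` lies in two triangles of `𝓔` and the family obtained by
contracting `u` to `v` is generically rigid, then so is `𝓔`. Placing `u` at the same point as `v`,
the two triangles force every motion to agree at `u` and `v`, so that it descends to the
contracted family. -/
lemma eventually_isRigid_of_contract {u v x y : V} {𝓔 : Finset (Finset V)} (huv : u ≠ v)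
    (h3 : ∀ F ∈ 𝓔, #F = 3) (hx : {u, v, x} ∈ 𝓔) (hy : {u, v, y} ∈ 𝓔) (hxy : x ≠ y)
    (hverts : ∀ F ∈ 𝓔, ∀ a ∈ F, a ≠ u →
      ∃ G ∈ 𝓔, ¬(u ∈ G ∧ v ∈ G) ∧ a ∈ contractFace u v G)
    (h : ∀ᶠ p in genericFilter V,
      IsRigid p ({F ∈ 𝓔 | ¬(u ∈ F ∧ v ∈ F)}.image (contractFace u v))) :
    ∀ᶠ p in genericFilter V, IsRigid p 𝓔 := by
  have hdist : ∀ w, {u, v, w} ∈ 𝓔 → u ≠ w ∧ v ≠ w := by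
    intro w hw
    have hc := h3 _ hw
    have hle := card_le_two (a := u) (b := v)
    constructor
    · rintro rfl
      rw [pair_comm v u, insert_eq_of_mem (mem_insert_self _ _)] at hc
      omega
    · rintro rfl
      rw [pair_eq_singleton] at hc
      omega
  obtain ⟨hux, hvx⟩ := hdist x hx
  obtain ⟨huy, hvy⟩ := hdist y hy
  have hvxy : #{v, x, y} = 3 := card_eq_three.2 ⟨v, x, y, hvx, hvy, hxy, rfl⟩
  obtain ⟨F₀, hF₀, huvF₀, -⟩ := hverts _ hx v (by simp) huv.symm
  obtain ⟨p, hrig, hpF₀, hpxy⟩ := (h.and ((eventually_linearIndependent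
    ((card_contractFace huvF₀).trans (h3 _ hF₀))).and (eventually_linearIndependent hvxy))).exists
  -- the placement in which `u` is moved to the position of `v`
  set q : V → Fin 3 → ℝ := fun a => p (if a = u then v else a) with hq
  have hqu : q u = p v := by simp [hq]
  have hqa : ∀ {a}, a ≠ u → q a = p a := fun ha => by simp [hq, ha]
  have hqF₀ : LinearIndependent ℝ fun a : F₀ => q a := by
    refine hpF₀.comp (fun a : F₀ => (⟨_, mem_contractFace a.2⟩ : contractFace u v F₀)) ?_
    rintro ⟨a, ha⟩ ⟨b, hb⟩ hab
    simp only [Subtype.mk.injEq] at hab ⊢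
    split_ifs at hab with h1 h2 h2
    · rw [h1, h2]
    · exact absurd ⟨h1 ▸ ha, hab ▸ hb⟩ huvF₀
    · exact absurd ⟨h2 ▸ hb, hab ▸ ha⟩ huvF₀
    · exact hab
  refine IsRigid.eventually (q := q) ?_ hF₀ (h3 _ hF₀) hqF₀
  intro z hz
  have hz' : ∀ {F}, F ∈ 𝓔 → ∀ {a b}, a ∈ F → b ∈ F → z a ⬝ᵥ q b = z b ⬝ᵥ q a :=
    fun hF _ _ ha hb => hz _ hF _ ha _ hb
  have hzuv : z u = z v := by
    refine sub_eq_zero.1 (eq_zero_of_forall_dotProduct hvxy hpxy fun a ha => ?_)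
    rw [sub_dotProduct, sub_eq_zero]
    have key : ∀ w, u ≠ w → {u, v, w} ∈ 𝓔 → z u ⬝ᵥ p w = z v ⬝ᵥ p w := by
      intro w huw hw
      have h1 := hz' hw (a := u) (b := w) (by simp) (by simp)
      have h2 := hz' hw (a := v) (b := w) (by simp) (by simp)
      rw [hqu, hqa huw.symm] at h1
      rw [hqa huv.symm, hqa huw.symm] at h2
      rw [h1, h2]
    simp only [mem_insert, mem_singleton] at ha
    rcases ha with rfl | rfl | rfl
    · have h1 := hz' hx (a := u) (b := a) (by simp) (by simp)
      rwa [hqu, hqa huv.symm] at h1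
    · exact key _ hux hx
    · exact key _ huy hy
  have hza : ∀ a, z (if a = u then v else a) = z a := by
    intro a
    split_ifs with h
    · rw [h, hzuv]
    · rfl
  obtain ⟨A, hA⟩ := hrig z (by
    intro G hG a ha b hb
    obtain ⟨F, hF, rfl⟩ := mem_image.1 hG
    obtain ⟨a', ha', rfl⟩ := exists_mem_of_mem_contractFace ha
    obtain ⟨b', hb', rfl⟩ := exists_mem_of_mem_contractFace hb
    rw [hza, hza]
    exact hz' (mem_filter.1 hF).1 ha' hb')
  have hAv : ∀ F ∈ 𝓔, ∀ a ∈ F, a ≠ u → z a = A (p a) := by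
    intro F hF a ha hau
    obtain ⟨G, hG, huvG, haG⟩ := hverts F hF a ha hau
    exact hA _ (mem_image_of_mem _ (mem_filter.2 ⟨hG, huvG⟩)) a haG
  refine ⟨A, fun F hF a ha => ?_⟩
  by_cases hau : a = u
  · rw [hau, hzuv, hqu]
    exact hAv _ hx v (by simp) huv.symm
  · rw [hqa hau]
    exact hAv F hF a ha hau

end VertexSplit

/-! ### Minimal 2-cycles are generically rigid -/

section Fogelsanger

variable {V : Type*} [LinearOrder V] {Γ : Type*} [AddCommGroup Γ]

lemma exists_notMem_erase_subset {c : Finset V →₀ Γ} (hc : boundaryHom c = 0)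
    {F : Finset V} (hF : F ∈ c.support) {w : V} (hw : w ∈ F) :
    ∃ F' ∈ c.support, w ∉ F' ∧ F.erase w ⊆ F' := by
  obtain ⟨F', hF', hne, y, hy, h⟩ := exists_ne_mem_support_of_boundaryHom_eq_zero hc hF hw
  refine ⟨F', hF', fun hwF' => hne ?_, h ▸ erase_subset _ _⟩
  have hyw : y = w := by
    by_contra hyw
    exact notMem_erase w F (h ▸ mem_erase.2 ⟨Ne.symm hyw, hwF'⟩)
  rw [← insert_erase hy, h, hyw, insert_erase hw]

lemma isSimplicialCycle_contractHom {i : ℤ} {c : Finset V →₀ Γ} (hc : IsSimplicialCycle i c)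
    {u v : V} (huv : u ≠ v) : IsSimplicialCycle i (contractHom u v c) := by
  rw [isSimplicialCycle_iff] at hc ⊢
  refine ⟨fun G hG => ?_, ?_⟩
  · obtain ⟨F, hF, huvF, rfl⟩ := exists_of_contractHom_ne_zero huv (Finsupp.mem_support_iff.1 hG)
    rw [card_contractFace huvF]
    exact hc.1 F hF
  · rw [← boundaryHom_fillHom, fillHom_apply, hc.2, map_zero, add_zero, hc.2]

lemma card_support_contractHom_lt {c : Finset V →₀ Γ} {u v : V} (huv : u ≠ v) {F : Finset V}
    (hF : F ∈ c.support) (hu : u ∈ F) (hv : v ∈ F) :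
    #(contractHom u v c).support < #c.support := by
  refine (card_le_card (t := {F ∈ c.support | ¬(u ∈ F ∧ v ∈ F)}.image (contractFace u v))
    fun G hG => ?_).trans_lt (card_image_le.trans_lt (card_lt_card ?_))
  · obtain ⟨F, hF, huvF, rfl⟩ := exists_of_contractHom_ne_zero huv (Finsupp.mem_support_iff.1 hG)
    exact mem_image_of_mem _ (mem_filter.2 ⟨hF, huvF⟩)
  · exact filter_ssubset.2 ⟨F, hF, fun h => h ⟨hu, hv⟩⟩

lemma fillHom_apply_of_not {b : Finset V →₀ Γ} {u v : V} {F : Finset V}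
    (h : ¬(u ∈ F ∧ v ∈ F)) : fillHom u v b F = b F := by
  rw [fillHom_apply, Finsupp.add_apply, add_eq_left]
  by_contra h0
  exact h ⟨(prismHom_apply_ne_zero h0).1, (prismHom_apply_ne_zero h0).2.1⟩

lemma card_of_mem_support_fillHom {b : Finset V →₀ Γ} {u v : V} {k : ℕ}
    (hb : ∀ F ∈ b.support, #F = k) {F : Finset V} (hF : F ∈ (fillHom u v b).support) : #F = k := by
  by_cases hbF : F ∈ b.support
  · exact hb F hbF
  · rw [Finsupp.mem_support_iff, fillHom_apply, Finsupp.add_apply,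
      Finsupp.notMem_support_iff.1 hbF, zero_add] at hF
    obtain ⟨-, hv, h⟩ := prismHom_apply_ne_zero hF
    obtain ⟨F', hF', y, hy, h⟩ := exists_mem_support_of_boundaryHom_ne_zero h
    rw [← hb F' hF', ← card_erase_add_one hy, h, card_erase_add_one hv]

/-- Lifting rigidity along a contraction: let `b` be a chain of triangles, none of which contains
`uv`, such that the contraction of `b` is a cycle while `b` itself is not. Then filling in the
triangles through `uv` yields a family to which vertex splitting applies. -/
lemma eventually_isRigid_fillHom {b : Finset V →₀ Γ} {u v : V} (huv : u ≠ v)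
    (hb3 : ∀ F ∈ b.support, #F = 3) (hb : ∀ F ∈ b.support, ¬(u ∈ F ∧ v ∈ F))
    (hcyc : boundaryHom (fillHom u v b) = 0) (hne : fillHom u v b ≠ b)
    (h : ∀ᶠ p in genericFilter V, IsRigid p (b.support.image (contractFace u v))) :
    ∀ᶠ p in genericFilter V, IsRigid p (fillHom u v b).support := by
  obtain ⟨G, hG⟩ := Finsupp.ne_iff.1 hne
  have huvG : u ∈ G ∧ v ∈ G := by
    by_contra huvG
    exact hG (fillHom_apply_of_not huvG)
  have hGs : G ∈ (fillHom u v b).support := by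
    rw [Finsupp.mem_support_iff]
    intro h0
    rw [h0] at hG
    exact hb G (Finsupp.mem_support_iff.2 hG.symm) huvG
  have h3 : ∀ F ∈ (fillHom u v b).support, #F = 3 := fun F => card_of_mem_support_fillHom hb3
  have hGc : #((G.erase u).erase v) = 1 := by
    rw [card_erase_of_mem (mem_erase.2 ⟨huv.symm, huvG.2⟩), card_erase_of_mem huvG.1, h3 G hGs]
  obtain ⟨x, hx⟩ := card_eq_one.1 hGc
  have hGx : G = {u, v, x} := by
    rw [← hx, insert_erase (mem_erase.2 ⟨huv.symm, huvG.2⟩), insert_erase huvG.1]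
  have hxG : x ∈ (G.erase u).erase v := hx ▸ mem_singleton_self x
  simp only [mem_erase] at hxG
  -- the cycle condition at the edge `uv` provides a second triangle
  obtain ⟨G', hG', hGG', y, hy, hyx⟩ :=
    exists_ne_mem_support_of_boundaryHom_eq_zero hcyc hGs hxG.2.2
  have hGy : G' = {u, v, y} := by
    have he : G.erase x = {u, v} := by
      ext w
      rw [hGx]
      simp only [mem_erase, mem_insert, mem_singleton]
      constructor
      · tauto
      · rintro (rfl | rfl)
        · exact ⟨Ne.symm hxG.2.1, Or.inl rfl⟩
        · exact ⟨Ne.symm hxG.1, Or.inr (Or.inl rfl)⟩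
    rw [← insert_erase hy, hyx, he]
    ext w
    simp only [mem_insert, mem_singleton]
    tauto
  have hxy : x ≠ y := fun h => hGG' (by rw [hGx, hGy, h])
  refine eventually_isRigid_of_contract huv h3 (hGx ▸ hGs) (hGy ▸ hG') hxy ?_ ?_
  · intro F hF a ha hau
    by_cases hF' : u ∈ F ∧ v ∈ F
    · obtain ⟨F', hF's, huF', hsub⟩ := exists_notMem_erase_subset hcyc hF hF'.1
      refine ⟨F', hF's, fun h => huF' h.1, ?_⟩
      have := mem_contractFace (u := u) (v := v) (hsub (mem_erase.2 ⟨hau, ha⟩))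
      rwa [if_neg hau] at this
    · refine ⟨F, hF, hF', ?_⟩
      have := mem_contractFace (u := u) (v := v) ha
      rwa [if_neg hau] at this
  · convert h using 5
    ext F
    rw [mem_filter, Finsupp.mem_support_iff, Finsupp.mem_support_iff]
    constructor
    · rintro ⟨h1, h2⟩
      rwa [fillHom_apply_of_not h2] at h1
    · intro h1
      have h2 := hb F (Finsupp.mem_support_iff.2 h1)
      exact ⟨by rwa [fillHom_apply_of_not h2], h2⟩

open Classical in
/-- **Fogelsanger's theorem** in dimension two, for hyperconnectivity: the support of a minimal
`2`-cycle over any abelian group is generically rigid in `ℝ³`.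

The contraction of an edge `uv` decomposes into minimal cycles with fewer triangles. Each part
lifts to a cycle `e i`, to which vertex splitting applies; the minimality of `c` is used
to see that every part acquires triangles through `uv`. Now `c` is the sum of the `e i`, each of
which is rigid, and the linear maps induced on the triangles by a motion form a labelling to which
`IsMinimalCycle.label_eq` applies. -/
theorem eventually_isRigid_support {c : Finset V →₀ Γ} (hc : IsMinimalCycle 2 c) :
    ∀ᶠ p in genericFilter V, IsRigid p c.support := by
  induction hn : #c.support using Nat.strong_induction_on generalizing c with
  | _ n ih =>
  by_cases hc0 : c = 0
  · exact Filter.Eventually.of_forall fun p z _ => ⟨0, by simp [hc0]⟩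
  obtain ⟨hc3, hcb⟩ := isSimplicialCycle_iff.1 hc.1
  replace hc3 : ∀ F ∈ c.support, #F = 3 := fun F hF => by have := hc3 F hF; omega
  obtain ⟨F₀, hF₀⟩ := Finsupp.support_nonempty_iff.2 hc0
  obtain ⟨u, hu, v, hv, huv⟩ := one_lt_card.1 (by rw [hc3 F₀ hF₀]; norm_num : 1 < #F₀)
  set c' := contractHom u v c with hc'
  have hc'cyc := isSimplicialCycle_contractHom hc.1 huv
  have hc'lt := card_support_contractHom_lt huv hF₀ hu hv
  rw [hn] at hc'lt
  obtain ⟨l, hl⟩ := exists_label_isMinimalCycle hc'cyc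
  have hrig : ∀ j, ∀ᶠ p in genericFilter V, IsRigid p (c'.filter (l · = j)).support := fun j =>
    ih _ ((card_le_card (filter_subset _ _)).trans_lt hc'lt) (hl j) rfl
  -- triangles that cancel in the contraction are labelled by themselves
  let m : Finset V → Finset V ⊕ ℕ := fun G => if c' G = 0 then Sum.inl G else Sum.inr (l G)
  let b : Finset V ⊕ ℕ → Finset V →₀ Γ := fun i =>
    c.filter fun F => ¬(u ∈ F ∧ v ∈ F) ∧ m (contractFace u v F) = i
  let I : Finset (Finset V ⊕ ℕ) :=
    {F ∈ c.support | ¬(u ∈ F ∧ v ∈ F)}.image fun F => m (contractFace u v F)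
  have hmem_b : ∀ {i F}, F ∈ (b i).support ↔
      F ∈ c.support ∧ ¬(u ∈ F ∧ v ∈ F) ∧ m (contractFace u v F) = i := by
    intro i F
    rw [Finsupp.support_filter, mem_filter]
  have hb3 : ∀ i, ∀ F ∈ (b i).support, #F = 3 := fun i F hF => hc3 F (hmem_b.1 hF).1
  have hcontr : ∀ i, contractHom u v (b i) = c'.filter (m · = i) := fun i =>
    contractHom_filter huv (m · = i) c
  have hinl : ∀ G, c'.filter (m · = Sum.inl G) = 0 := by
    intro G
    refine (Finsupp.filter_eq_zero_iff _ _).2 fun G' hG' => ?_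
    by_contra h0
    simp [m, h0] at hG'
  have hinr : ∀ j, c'.filter (m · = Sum.inr j) = c'.filter (l · = j) := by
    intro j
    ext G
    simp only [Finsupp.filter_apply, m]
    by_cases h0 : c' G = 0 <;> simp [h0]
  have hcyc : ∀ i, boundaryHom (fillHom u v (b i)) = 0 := by
    intro i
    rw [boundaryHom_fillHom, hcontr]
    rcases i with G | j
    · rw [hinl, map_zero]
    · rw [hinr]
      exact (isSimplicialCycle_iff.1 (hl j).1).2
  have hsum : ∑ i ∈ I, fillHom u v (b i) = c := by
    rw [← map_sum]
    conv_rhs => rw [← fillHom_filter_eq_self huv hcb]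
    congr 1
    ext F
    rw [Finsupp.finsetSum_apply]
    simp only [b, Finsupp.filter_apply]
    by_cases hF : u ∈ F ∧ v ∈ F
    · simp [hF]
    · simp only [hF, not_false_eq_true, true_and, if_true, sum_ite_eq]
      rw [ite_eq_left_iff]
      intro hmI
      by_contra h0
      exact hmI (mem_image_of_mem _ (mem_filter.2
        ⟨Finsupp.mem_support_iff.2 (Ne.symm h0), hF⟩))
  have hrig_e : ∀ i ∈ I, ∀ᶠ p in genericFilter V, IsRigid p (fillHom u v (b i)).support := by
    intro i hi
    obtain ⟨F₁, hF₁, hi⟩ := mem_image.1 hi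
    obtain ⟨hF₁, huvF₁⟩ := mem_filter.1 hF₁
    have hF₁b : F₁ ∈ (b i).support := hmem_b.2 ⟨hF₁, huvF₁, hi⟩
    refine eventually_isRigid_fillHom huv (hb3 i) (fun F hF => (hmem_b.1 hF).2.1) (hcyc i) ?_ ?_
    · -- otherwise `b i` would be a proper nonzero subchain of `c` that is a cycle
      intro heq
      have hbi := hcyc i
      rw [heq] at hbi
      rcases hc.2 (b i) (isSimplicialCycle_iff.2
        ⟨fun F hF => by rw [hb3 i F hF]; norm_num, hbi⟩) (isSubchain_filter c _) with h | h
      · rw [← h] at hF₀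
        exact (hmem_b.1 hF₀).2.1 ⟨hu, hv⟩
      · rw [h] at hF₁b
        simp at hF₁b
    · rcases i with G | j
      · have himg : (b (Sum.inl G)).support.image (contractFace u v) = {G} := by
          have hG : ∀ F ∈ (b (Sum.inl G)).support, contractFace u v F = G := by
            intro F hF
            have := (hmem_b.1 hF).2.2
            simp only [m] at this
            split_ifs at this
            exact Sum.inl_injective this
          refine eq_singleton_iff_unique_mem.2 ⟨mem_image.2 ⟨F₁, hF₁b, hG _ hF₁b⟩, ?_⟩
          intro G' hG'
          obtain ⟨F, hF, rfl⟩ := mem_image.1 hG'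
          exact hG F hF
        have hG3 : #G = 3 := by
          obtain ⟨F, hF, hFG⟩ := mem_image.1 (himg ▸ mem_singleton_self G)
          rw [← hFG, card_contractFace (hmem_b.1 hF).2.1, hb3 _ F hF]
        rw [himg]
        exact (eventually_linearIndependent hG3).mono fun p hp => isRigid_singleton hG3 hp
      · convert hrig j using 3
        ext G
        rw [mem_image]
        constructor
        · rintro ⟨F, hF, rfl⟩
          have := (hmem_b.1 hF).2.2
          simp only [m] at this
          split_ifs at this with h0
          rw [Finsupp.support_filter, mem_filter, Finsupp.mem_support_iff]
          exact ⟨h0, Sum.inr_injective this⟩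
        · intro hG
          rw [← hinr, ← hcontr, Finsupp.mem_support_iff] at hG
          obtain ⟨F, hF, -, h⟩ := exists_of_contractHom_ne_zero huv hG
          exact ⟨F, hF, h⟩
  have h3e : ∀ i, ∀ F ∈ (fillHom u v (b i)).support, #F = 3 := fun i F =>
    card_of_mem_support_fillHom (hb3 i)
  filter_upwards [(Filter.eventually_all_finset I).2 hrig_e, (Filter.eventually_all_finset I).2
    fun i _ => (Filter.eventually_all_finset (fillHom u v (b i)).support).2
      fun F hF => eventually_linearIndependent (h3e i F hF)] with p hp hpT
  intro z hz
  have hmot : ∀ i, IsMotion p (fillHom u v (b i)).support z := by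
    intro i
    have hsub : ∀ F ∈ (fillHom u v (b i)).support, ¬(u ∈ F ∧ v ∈ F) → F ∈ c.support := by
      intro F hF huvF
      rw [Finsupp.mem_support_iff, fillHom_apply_of_not huvF] at hF
      exact (hmem_b.1 (Finsupp.mem_support_iff.2 hF)).1
    refine hz.mono fun F hF a ha d hd had => ?_
    by_cases huvF : u ∈ F ∧ v ∈ F
    · by_cases h1 : a ≠ u ∧ d ≠ u
      · obtain ⟨F', hF', huF', hs⟩ := exists_notMem_erase_subset (hcyc i) hF huvF.1
        exact ⟨F', hsub F' hF' fun h => huF' h.1, hs (mem_erase.2 ⟨h1.1, ha⟩),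
          hs (mem_erase.2 ⟨h1.2, hd⟩)⟩
      · by_cases h2 : a ≠ v ∧ d ≠ v
        · obtain ⟨F', hF', hvF', hs⟩ := exists_notMem_erase_subset (hcyc i) hF huvF.2
          exact ⟨F', hsub F' hF' fun h => hvF' h.2, hs (mem_erase.2 ⟨h2.1, ha⟩),
            hs (mem_erase.2 ⟨h2.2, hd⟩)⟩
        · refine ⟨F₀, hF₀, ?_⟩
          have : (a = u ∧ d = v) ∨ (a = v ∧ d = u) := by grind
          rcases this with ⟨rfl, rfl⟩ | ⟨rfl, rfl⟩
          · exact ⟨hu, hv⟩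
          · exact ⟨hv, hu⟩
    · exact ⟨F, hsub F hF huvF, ha, hd⟩
  have hcover : ∀ F ∈ c.support, ∃ i ∈ I, F ∈ (fillHom u v (b i)).support := by
    intro F hF
    rw [Finsupp.mem_support_iff, ← hsum, Finsupp.finsetSum_apply] at hF
    obtain ⟨i, hi, h⟩ := exists_ne_zero_of_sum_ne_zero hF
    exact ⟨i, hi, Finsupp.mem_support_iff.2 h⟩
  -- the label of a triangle is the linear map that induces the motion on it
  have hA : ∀ F : Finset V, ∃ A : (Fin 3 → ℝ) →ₗ[ℝ] (Fin 3 → ℝ),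
      (∃ i ∈ I, F ∈ (fillHom u v (b i)).support) → ∀ a ∈ F, z a = A (p a) := by
    intro F
    by_cases hF : ∃ i ∈ I, F ∈ (fillHom u v (b i)).support
    · obtain ⟨i, hi, hF⟩ := hF
      obtain ⟨A, hA⟩ := hp i hi z (hmot i)
      exact ⟨A, fun _ => hA F hF⟩
    · exact ⟨0, fun h => absurd h hF⟩
  choose L hL using hA
  have hconst : ∀ i ∈ I, ∀ F ∈ (fillHom u v (b i)).support,
      ∀ F' ∈ (fillHom u v (b i)).support, L F = L F' := by
    intro i hi
    obtain ⟨A, hA⟩ := hp i hi z (hmot i)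
    have hLA : ∀ F ∈ (fillHom u v (b i)).support, L F = A := fun F hF =>
      linearMap_eq_of_eqOn (h3e i F hF) (hpT i hi F hF) fun a ha => by
        rw [← hL F ⟨i, hi, hF⟩ a ha, hA F hF a ha]
    intro F hF F' hF'
    rw [hLA F hF, hLA F' hF']
  have hfilter := boundaryHom_filter_eq_zero_of_sum (fun i (_ : i ∈ I) => hcyc i) hconst
  rw [hsum] at hfilter
  refine ⟨L F₀, fun F hF a ha => ?_⟩
  rw [← hc.label_eq hfilter hF hF₀]
  exact hL F (hcover F hF) a ha

end Fogelsanger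

/-! ### Colour-selected triangles of a properly coloured minimal cycle -/

section Balanced

variable {V : Type*} [LinearOrder V] {Γ : Type*} [AddCommGroup Γ]

/-- The vertices of `F` whose colour lies in `T`. -/
abbrev colorPart {α : Type*} [DecidableEq α] (κ : V → α) (T : Finset α) (F : Finset V) :
    Finset V := {a ∈ F | κ a ∈ T}

section

variable {α : Type*} [Fintype α] [DecidableEq α] {κ : V → α} {T : Finset α}

omit [LinearOrder V] in
lemma image_eq_univ_of_rainbow {F : Finset V} (hF : #F = Fintype.card α) (hκ : Set.InjOn κ F) :
    F.image κ = univ :=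
  eq_univ_of_card _ ((card_image_of_injOn hκ).trans hF)

omit [LinearOrder V] in
lemma card_colorPart {F : Finset V} (hF : #F = Fintype.card α) (hκ : Set.InjOn κ F) :
    #(colorPart κ T F) = #T := by
  rw [← card_image_of_injOn (hκ.mono (filter_subset (κ · ∈ T) F))]
  congr 1
  ext t
  simp only [mem_image, mem_filter]
  constructor
  · rintro ⟨a, ⟨-, h⟩, rfl⟩
    exact h
  · intro ht
    obtain ⟨a, ha, rfl⟩ := mem_image.1 (image_eq_univ_of_rainbow hF hκ ▸ mem_univ t)
    exact ⟨a, ⟨ha, ht⟩, rfl⟩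

lemma eq_colorPart_union {F G : Finset V} (hF : #F = Fintype.card α) (hκF : Set.InjOn κ F)
    (hd : Disjoint G {a ∈ F | κ a ∉ T})
    (hκG : Set.InjOn κ (G ∪ {a ∈ F | κ a ∉ T} : Finset V)) :
    colorPart κ T (G ∪ {a ∈ F | κ a ∉ T}) = G := by
  ext a
  simp only [mem_filter, mem_union]
  constructor
  · rintro ⟨h | h, hT⟩
    · exact h
    · exact absurd hT h.2
  · intro ha
    refine ⟨Or.inl ha, ?_⟩
    by_contra hT
    obtain ⟨b, hb, hba⟩ := mem_image.1 (image_eq_univ_of_rainbow hF hκF ▸ mem_univ (κ a))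
    have hbσ : b ∈ ({a ∈ F | κ a ∉ T} : Finset V) := mem_filter.2 ⟨hb, hba ▸ hT⟩
    have := hκG (mem_coe.2 (mem_union_right _ hbσ)) (mem_coe.2 (mem_union_left _ ha)) hba
    exact disjoint_left.1 hd ha (this ▸ hbσ)

open Classical in
/-- In a minimal cycle all of whose faces carry every colour exactly once, the triangles formed by
the vertices of three given colours are generically rigid.

The link of a face of the complementary colours is a `2`-cycle, hence a sum of minimal cycles with
disjoint supports, each of which is rigid. Label a face by the linear map that a given motion
induces on its selected triangle. The label classes are cycles: at a codimension one face that
misses a selected colour this holds because the parts of the link are rigid, and at any other one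
because all faces around it have the same selected triangle. -/
theorem eventually_isRigid_image_colorPart (hT : #T = 3) {i : ℤ} {c : Finset V →₀ Γ}
    (hc : IsMinimalCycle i c) (hcard : ∀ F ∈ c.support, #F = Fintype.card α)
    (hκ : ∀ F ∈ c.support, Set.InjOn κ F) :
    ∀ᶠ p in genericFilter V, IsRigid p (c.support.image (colorPart κ T)) := by
  have hcb := (isSimplicialCycle_iff.1 hc.1).2
  have h3 : ∀ F ∈ c.support, #(colorPart κ T F) = 3 := fun F hF =>
    (card_colorPart (hcard F hF) (hκ F hF)).trans hT
  let τ : Finset V → Finset V := fun F => {a ∈ F | κ a ∉ T}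
  let e : Finset V → Finset V →₀ Γ := fun σ => linkListHom σ.toList c
  have he_supp : ∀ F₁ ∈ c.support, ∀ G ∈ (e (τ F₁)).support,
      G ∪ τ F₁ ∈ c.support ∧ colorPart κ T (G ∪ τ F₁) = G := by
    intro F₁ hF₁ G hG
    obtain ⟨ε, -, h⟩ := linkListHom_apply (Γ := Γ) (τ F₁).nodup_toList G
    rw [Finsupp.mem_support_iff, h, toList_toFinset] at hG
    obtain ⟨hd, h0⟩ : Disjoint G (τ F₁) ∧ ε • c (G ∪ τ F₁) ≠ 0 := by
      split_ifs at hG with hd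
      · exact ⟨hd, hG⟩
      · exact absurd rfl hG
    have hmem : G ∪ τ F₁ ∈ c.support :=
      Finsupp.mem_support_iff.2 fun h => h0 (by rw [h, smul_zero])
    exact ⟨hmem, eq_colorPart_union (hcard F₁ hF₁) (hκ F₁ hF₁) hd (hκ _ hmem)⟩
  have he_cyc : ∀ σ ∈ c.support.image τ, IsSimplicialCycle 2 (e σ) := by
    intro σ hσ
    obtain ⟨F₁, hF₁, rfl⟩ := mem_image.1 hσ
    refine isSimplicialCycle_iff.2 ⟨fun G hG => ?_, ?_⟩
    · obtain ⟨hmem, hG'⟩ := he_supp F₁ hF₁ G hG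
      rw [← hG', h3 _ hmem]
      norm_num
    · have := linkListHom_boundaryHom (τ F₁).toList c
      rw [hcb, map_zero] at this
      rcases this with h | h
      · exact h.symm
      · exact neg_eq_zero.1 h.symm
  choose! l hl using fun σ hσ => exists_label_isMinimalCycle (he_cyc σ hσ)
  filter_upwards [(Filter.eventually_all_finset (c.support.image τ)).2 fun σ hσ =>
      (Filter.eventually_all_finset ((e σ).support.image (l σ))).2 fun j _ =>
        eventually_isRigid_support (hl σ hσ j),
    (Filter.eventually_all_finset c.support).2 fun F hF =>
      eventually_linearIndependent (h3 F hF)] with p hp hpT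
  intro z hz
  choose L hL using fun G : Finset V =>
    show ∃ A : (Fin 3 → ℝ) →ₗ[ℝ] (Fin 3 → ℝ), G ∈ c.support.image (colorPart κ T) →
        ∀ a ∈ G, z a = A (p a) by
      by_cases hG : G ∈ c.support.image (colorPart κ T)
      · obtain ⟨F, hF, rfl⟩ := mem_image.1 hG
        obtain ⟨A, hA⟩ := exists_linearMap_eqOn (h3 F hF) (hpT F hF) z
        exact ⟨A, fun _ => hA⟩
      · exact ⟨0, fun h => absurd h hG⟩
  -- the label classes of the links are cycles
  have hlink : ∀ σ ∈ c.support.image τ, ∀ A, boundaryHom ((e σ).filter (L · = A)) = 0 := by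
    intro σ hσ A
    have himg : ∀ G ∈ (e σ).support, G ∈ c.support.image (colorPart κ T) := by
      intro G hG
      obtain ⟨F₁, hF₁, rfl⟩ := mem_image.1 hσ
      obtain ⟨hmem, hG'⟩ := he_supp F₁ hF₁ G hG
      exact mem_image.2 ⟨_, hmem, hG'⟩
    have hsum : ∑ j ∈ (e σ).support.image (l σ), (e σ).filter (l σ · = j) = e σ := by
      ext G
      rw [Finsupp.finsetSum_apply]
      simp only [Finsupp.filter_apply, sum_ite_eq, ite_eq_left_iff]
      intro hG
      by_contra h0
      exact hG (mem_image_of_mem _ (Finsupp.mem_support_iff.2 (Ne.symm h0)))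
    rw [← hsum]
    refine boundaryHom_filter_eq_zero_of_sum
      (fun j _ => (isSimplicialCycle_iff.1 (hl σ hσ j).1).2) (fun j hj => ?_) A
    have hsub : ∀ G ∈ ((e σ).filter (l σ · = j)).support,
        G ∈ c.support.image (colorPart κ T) := fun G hG =>
      himg G (mem_filter.1 (Finsupp.support_filter (l σ · = j) (e σ) ▸ hG)).1
    obtain ⟨A', hA'⟩ := hp σ hσ j hj z fun G hG => hz G (hsub G hG)
    have hLA : ∀ G ∈ ((e σ).filter (l σ · = j)).support, L G = A' := by
      intro G hG
      obtain ⟨F, hF, rfl⟩ := mem_image.1 (hsub G hG)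
      exact linearMap_eq_of_eqOn (h3 F hF) (hpT F hF) fun a ha => by
        rw [← hL _ (hsub _ hG) a ha, hA' _ hG a ha]
    intro G hG G' hG'
    rw [hLA G hG, hLA G' hG']
  have hfilter : ∀ A, boundaryHom (c.filter fun F => L (colorPart κ T F) = A) = 0 := by
    intro A
    ext H
    rw [Finsupp.zero_apply]
    by_contra hne
    obtain ⟨F, hF, x, hx, rfl⟩ := exists_mem_support_of_boundaryHom_ne_zero hne
    rw [Finsupp.support_filter, mem_filter] at hF
    obtain ⟨hF, hFA⟩ := hF
    by_cases hxT : κ x ∈ T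
    · have hτ : τ F = τ (F.erase x) := by
        ext a
        simp only [τ, mem_filter, mem_erase]
        constructor
        · rintro ⟨h1, h2⟩
          exact ⟨⟨fun h => h2 (h ▸ hxT), h1⟩, h2⟩
        · rintro ⟨⟨-, h1⟩, h2⟩
          exact ⟨h1, h2⟩
      have hunion : colorPart κ T (F.erase x) ∪ τ F = F.erase x := by
        rw [hτ]
        exact filter_union_filter_not_eq _ _
      have hdisj : Disjoint (colorPart κ T (F.erase x)) (τ F) := by
        rw [hτ]
        exact disjoint_filter_filter_not _ _ _
      have hb : linkListHom (τ F).toList (c.filter fun F => L (colorPart κ T F) = A) =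
          (e (τ F)).filter (L · = A) := by
        ext G
        obtain ⟨ε, -, h⟩ := linkListHom_apply (Γ := Γ) (τ F).nodup_toList G
        rw [Finsupp.filter_apply, h, h, toList_toFinset, Finsupp.filter_apply]
        by_cases hd : Disjoint G (τ F)
        · rw [if_pos hd, if_pos hd]
          by_cases h0 : G ∪ τ F ∈ c.support
          · have hG : colorPart κ T (G ∪ τ F) = G :=
              eq_colorPart_union (hcard F hF) (hκ F hF) hd (hκ _ h0)
            rw [hG]
            split_ifs <;> simp
          · rw [Finsupp.notMem_support_iff.1 h0]
            simp
        · simp [hd]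
      obtain ⟨ε, hε, h⟩ := linkListHom_apply (Γ := Γ) (τ F).nodup_toList
        (colorPart κ T (F.erase x))
      have h1 := h (boundaryHom (c.filter fun F => L (colorPart κ T F) = A))
      rw [toList_toFinset, if_pos hdisj, hunion] at h1
      have h2 : linkListHom (τ F).toList
          (boundaryHom (c.filter fun F => L (colorPart κ T F) = A)) = 0 := by
        have h3 := linkListHom_boundaryHom (τ F).toList
          (c.filter fun F => L (colorPart κ T F) = A)
        rw [hb, hlink (τ F) (mem_image_of_mem _ hF), neg_zero, or_self] at h3
        exact h3
      rw [h2, Finsupp.zero_apply] at h1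
      rcases hε with rfl | rfl
      · exact hne (by simpa using h1.symm)
      · exact hne (by simpa using h1.symm)
    · refine hne ((boundaryHom_congr (c := c) fun F' y hy hFF' => ?_).trans (by rw [hcb]; rfl))
      rw [Finsupp.filter_apply, ite_eq_left_iff]
      intro hF'A
      by_contra h0
      have hF' : F' ∈ c.support := Finsupp.mem_support_iff.2 (Ne.symm h0)
      have h1 : colorPart κ T (F.erase x) = colorPart κ T F := by
        ext a
        simp only [mem_filter, mem_erase]
        constructor
        · rintro ⟨⟨-, h1⟩, h2⟩
          exact ⟨h1, h2⟩
        · rintro ⟨h1, h2⟩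
          exact ⟨⟨fun h => hxT (h ▸ h2), h1⟩, h2⟩
      have h2 : colorPart κ T F = colorPart κ T F' := by
        refine eq_of_subset_of_card_le ?_ (by rw [h3 F hF, h3 F' hF'])
        rw [← h1, ← hFF']
        exact filter_subset_filter _ (erase_subset _ _)
      exact hF'A (h2 ▸ hFA)
  by_cases hc0 : c.support = ∅
  · exact ⟨0, by simp [hc0]⟩
  obtain ⟨F₀, hF₀⟩ := nonempty_iff_ne_empty.2 hc0
  refine ⟨L (colorPart κ T F₀), fun G hG a ha => ?_⟩
  obtain ⟨F, hF, rfl⟩ := mem_image.1 hG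
  rw [← hc.label_eq (L := fun F => L (colorPart κ T F)) hfilter hF hF₀]
  exact hL _ hG a ha

omit [Fintype α] in
lemma familyVerts_image_colorPart (𝓢 : Finset (Finset V)) :
    familyVerts (𝓢.image (colorPart κ T)) = {a ∈ familyVerts 𝓢 | κ a ∈ T} := by
  ext a
  simp only [mem_biUnion, mem_image, mem_filter, id]
  constructor
  · rintro ⟨_, ⟨F, hF, rfl⟩, ha⟩
    exact ⟨⟨F, hF, (mem_filter.1 ha).1⟩, (mem_filter.1 ha).2⟩
  · rintro ⟨⟨F, hF, ha⟩, haT⟩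
    exact ⟨_, ⟨F, hF, rfl⟩, mem_filter.2 ⟨ha, haT⟩⟩

omit [Fintype α] in
lemma familyEdges_image_colorPart (𝓢 : Finset (Finset V)) :
    familyEdges (𝓢.image (colorPart κ T)) = {e ∈ familyEdges 𝓢 | e.image κ ⊆ T} := by
  ext e
  simp only [mem_biUnion, mem_image, mem_filter, mem_powersetCard, image_subset_iff]
  constructor
  · rintro ⟨_, ⟨F, hF, rfl⟩, he, h2⟩
    exact ⟨⟨F, hF, fun a ha => (mem_filter.1 (he ha)).1, h2⟩, fun a ha => (mem_filter.1 (he ha)).2⟩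
  · rintro ⟨⟨F, hF, he, h2⟩, heT⟩
    exact ⟨_, ⟨F, hF, rfl⟩, fun a ha => mem_filter.2 ⟨he ha, heT a ha⟩, h2⟩

/-- Summing the edge bounds over all sets of three colours. -/
lemma choose_mul_card_familyVerts_le {𝓢 : Finset (Finset V)} (hne : 𝓢.Nonempty)
    (hcard : ∀ F ∈ 𝓢, #F = Fintype.card α) (hκ : ∀ F ∈ 𝓢, Set.InjOn κ F)
    (hrig : ∀ T : Finset α, #T = 3 →
      ∀ᶠ p in genericFilter V, IsRigid p (𝓢.image (colorPart κ T))) :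
    3 * ((Fintype.card α - 1).choose 2 * #(familyVerts 𝓢)) ≤
      (Fintype.card α - 2) * #(familyEdges 𝓢) + 6 * (Fintype.card α).choose 3 := by
  obtain ⟨F, hF⟩ := hne
  have hT : ∀ T ∈ powersetCard 3 (univ : Finset α),
      3 * #{a ∈ familyVerts 𝓢 | κ a ∈ T} ≤ #{e ∈ familyEdges 𝓢 | e.image κ ⊆ T} + 6 := by
    intro T hT
    have hT := (mem_powersetCard.1 hT).2
    have h3 := (card_colorPart (T := T) (hcard F hF) (hκ F hF)).trans hT
    obtain ⟨p, hp, hpF⟩ := ((hrig T hT).and (eventually_linearIndependent h3)).exists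
    rw [← familyVerts_image_colorPart, ← familyEdges_image_colorPart]
    exact hp.three_mul_card_le (mem_image_of_mem _ hF) h3 hpF
  have hle := sum_le_sum hT
  have hcount : ∀ S : Finset α, #S ≤ 3 → #{T ∈ powersetCard 3 (univ : Finset α) | S ⊆ T} =
      (Fintype.card α - #S).choose (3 - #S) := fun S hS => by
    rw [card_filter_powersetCard_subset S univ 3 (subset_univ S) hS, card_univ]
  have hv : ∑ T ∈ powersetCard 3 (univ : Finset α), #{a ∈ familyVerts 𝓢 | κ a ∈ T} =
      (Fintype.card α - 1).choose 2 * #(familyVerts 𝓢) := by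
    simp_rw [card_filter]
    rw [sum_comm, mul_comm]
    refine sum_const_nat fun a _ => ?_
    rw [← card_filter]
    have := hcount {κ a} (by simp)
    simpa using this
  have he : ∑ T ∈ powersetCard 3 (univ : Finset α), #{e ∈ familyEdges 𝓢 | e.image κ ⊆ T} =
      (Fintype.card α - 2) * #(familyEdges 𝓢) := by
    simp_rw [card_filter]
    rw [sum_comm, mul_comm]
    refine sum_const_nat fun e he => ?_
    rw [← card_filter]
    obtain ⟨F, hF, he⟩ := mem_biUnion.1 he
    obtain ⟨heF, he2⟩ := mem_powersetCard.1 he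
    have hc2 : #(e.image κ) = 2 := by
      rw [card_image_of_injOn ((hκ F hF).mono heF), he2]
    rw [hcount (e.image κ) (by omega), hc2]
    exact Nat.choose_one_right _
  rw [← mul_sum, hv, sum_add_distrib, he, sum_const, card_powersetCard, card_univ,
    smul_eq_mul] at hle
  omega

end

end Balanced

/-! ### Face numbers -/

section FaceNumbers

variable {V : Type*} [LinearOrder V]

lemma mem_faces_spanned {𝓢 : Finset (Finset V)} {G : Finset V} :
    G ∈ (FinSimplicialComplex.spanned 𝓢).faces ↔ ∃ F ∈ 𝓢, G ⊆ F := by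
  simp only [FinSimplicialComplex.spanned, mem_biUnion, mem_powerset]

lemma fNum_spanned_neg_one {𝓢 : Finset (Finset V)} (hne : 𝓢.Nonempty) :
    (FinSimplicialComplex.spanned 𝓢).fNum (-1) = 1 := by
  obtain ⟨F, hF⟩ := hne
  refine card_eq_one.2 ⟨∅, ?_⟩
  ext G
  rw [mem_filter, mem_faces_spanned, mem_singleton, faceDim]
  constructor
  · rintro ⟨-, h⟩
    exact card_eq_zero.1 (by omega)
  · rintro rfl
    exact ⟨⟨F, hF, empty_subset _⟩, by simp⟩

lemma fNum_spanned_zero (𝓢 : Finset (Finset V)) :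
    (FinSimplicialComplex.spanned 𝓢).fNum 0 = #(familyVerts 𝓢) := by
  rw [← card_image_of_injective (familyVerts 𝓢) (singleton_injective (α := V))]
  refine congrArg card ?_
  ext G
  rw [mem_filter, mem_faces_spanned, faceDim]
  simp only [mem_biUnion, mem_image, id]
  constructor
  · rintro ⟨⟨F, hF, hG⟩, h⟩
    obtain ⟨a, rfl⟩ := card_eq_one.1 (by omega : #G = 1)
    exact ⟨a, ⟨F, hF, singleton_subset_iff.1 hG⟩, rfl⟩
  · rintro ⟨a, ⟨F, hF, ha⟩, rfl⟩
    exact ⟨⟨F, hF, singleton_subset_iff.2 ha⟩, by simp⟩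

lemma fNum_spanned_one (𝓢 : Finset (Finset V)) :
    (FinSimplicialComplex.spanned 𝓢).fNum 1 = #(familyEdges 𝓢) := by
  refine congrArg card ?_
  ext G
  rw [mem_filter, mem_faces_spanned, faceDim]
  simp only [mem_biUnion, mem_powersetCard]
  constructor
  · rintro ⟨⟨F, hF, hG⟩, h⟩
    exact ⟨F, hF, hG, by omega⟩
  · rintro ⟨F, hF, hG, h⟩
    exact ⟨⟨F, hF, hG⟩, by omega⟩

/-- A colouring of the graph of a balanced complex, as a map on all of `V` that is injective on
faces. -/
lemma FinSimplicialComplex.IsBalanced.exists_injOn {Δ : FinSimplicialComplex V}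
    (h : Δ.IsBalanced) (hpos : 0 < Δ.maxCard) :
    ∃ κ : V → Fin Δ.maxCard, ∀ F ∈ Δ.faces, Set.InjOn κ F := by
  classical
  obtain ⟨C⟩ := h
  refine ⟨fun a => if ha : a ∈ Δ.vertexSet then C ⟨a, ha⟩ else ⟨0, hpos⟩, ?_⟩
  intro F hF a ha b hb hab
  have hvert : ∀ x ∈ F, x ∈ Δ.vertexSet := fun x hx =>
    Δ.down_closed F hF _ (singleton_subset_iff.2 hx)
  simp only [dif_pos (hvert a ha), dif_pos (hvert b hb)] at hab
  by_contra hne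
  refine C.valid (v := ⟨a, hvert a ha⟩) (w := ⟨b, hvert b hb⟩)
    ⟨fun h => hne (congrArg Subtype.val h), Δ.down_closed F hF _ ?_⟩ hab
  intro x hx
  rcases mem_insert.1 hx with rfl | hx
  · exact ha
  · rwa [mem_singleton.1 hx]

omit [LinearOrder V] in
/-- The numerical form of the inequality, in terms of the numbers of vertices and edges. -/
lemma two_mul_hNum_two_ge {Δ : FinSimplicialComplex V} {d : ℕ} (hd : 3 ≤ d) (hΔ : Δ.maxCard = d)
    (hempty : Δ.fNum (-1) = 1)
    (h : 3 * ((d - 1).choose 2 * Δ.fNum 0) ≤ (d - 2) * Δ.fNum 1 + 6 * d.choose 3) :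
    2 * Δ.hNum 2 ≥ ((d : ℤ) - 1) * Δ.hNum 1 := by
  obtain ⟨k, rfl⟩ := Nat.exists_eq_add_of_le' hd
  have h1 : Δ.hNum 1 = Δ.fNum 0 - (k + 3) := by
    simp [FinSimplicialComplex.hNum, sum_range_succ, hΔ, hempty]
    ring
  have h2 : Δ.hNum 2 = Δ.fNum 1 - (k + 2) * Δ.fNum 0 + (k + 3).choose 2 := by
    have e1 : (k + 3).choose (k + 1) = (k + 3).choose 2 := Nat.choose_symm_add (a := k + 1) (b := 2)
    simp [FinSimplicialComplex.hNum, sum_range_succ, hΔ, hempty, e1]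
    ring
  have c2 : (k + 3).choose 2 * 2 = (k + 3) * (k + 2) := by
    have := Nat.add_one_mul_choose_eq (k + 2) 1
    rw [Nat.choose_one_right] at this
    exact this.symm
  have c2' : (k + 2).choose 2 * 2 = (k + 2) * (k + 1) := by
    have := Nat.add_one_mul_choose_eq (k + 1) 1
    rw [Nat.choose_one_right] at this
    exact this.symm
  have c3 : (k + 3) * (k + 2).choose 2 = (k + 3).choose 3 * 3 := Nat.add_one_mul_choose_eq (k + 2) 2
  have e1 : k + 3 - 1 = k + 2 := rfl
  have e2 : k + 3 - 2 = k + 1 := rfl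
  rw [e1, e2] at h
  have key : 3 * (k + 2) * Δ.fNum 0 ≤ 2 * Δ.fNum 1 + 2 * ((k + 3) * (k + 2)) := by
    refine Nat.le_of_mul_le_mul_left (c := k + 1) ?_ (by omega)
    calc (k + 1) * (3 * (k + 2) * Δ.fNum 0) = 3 * ((k + 2) * (k + 1)) * Δ.fNum 0 := by ring
      _ = 2 * (3 * ((k + 2).choose 2 * Δ.fNum 0)) := by rw [← c2']; ring
      _ ≤ 2 * ((k + 1) * Δ.fNum 1 + 6 * (k + 3).choose 3) := by omega
      _ = 2 * (k + 1) * Δ.fNum 1 + 4 * ((k + 3).choose 3 * 3) := by ring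
      _ = 2 * (k + 1) * Δ.fNum 1 + 2 * ((k + 3) * ((k + 2).choose 2 * 2)) := by rw [← c3]; ring
      _ = (k + 1) * (2 * Δ.fNum 1 + 2 * ((k + 3) * (k + 2))) := by rw [c2']; ring
  rw [h1, h2]
  zify at key c2
  push_cast
  linarith

end FaceNumbers

theorem corollary4p3 {V : Type*} [LinearOrder V] {Γ : Type*} [AddCommGroup Γ]
    (d : ℕ) (hd : 3 ≤ d) (Δ : FinSimplicialComplex V)
    (hmin : IsMinimalCycleComplex Γ ((d : ℤ) - 1) Δ) (hbal : Δ.IsBalanced) :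
    2 * Δ.hNum 2 ≥ ((d : ℤ) - 1) * Δ.hNum 1 := by
  obtain ⟨hdim, hΔ⟩ := hmin
  have hmax : Δ.maxCard = d := by
    unfold FinSimplicialComplex.dim at hdim
    omega
  obtain ⟨κ, hκ⟩ := hbal.exists_injOn (by omega)
  have hcol : Fintype.card (Fin Δ.maxCard) = d := by rw [Fintype.card_fin, hmax]
  have hfacet : ∀ {𝓢 : Finset (Finset V)}, Δ = FinSimplicialComplex.spanned 𝓢 →
      ∀ F ∈ 𝓢, Set.InjOn κ F := by
    rintro 𝓢 h F hF
    refine hκ F ?_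
    rw [h]
    exact mem_biUnion.2 ⟨F, hF, mem_powerset_self F⟩
  -- it remains to prove that the colour-selected families of triangles are generically rigid
  suffices h : ∃ 𝓢 : Finset (Finset V), Δ = FinSimplicialComplex.spanned 𝓢 ∧ 𝓢.Nonempty ∧
      (∀ F ∈ 𝓢, #F = d) ∧ ∀ T : Finset (Fin Δ.maxCard), #T = 3 →
        ∀ᶠ p in genericFilter V, IsRigid p (𝓢.image (colorPart κ T)) by
    obtain ⟨𝓢, h𝓢, hne, hcard, hrig⟩ := h
    have hle := choose_mul_card_familyVerts_le hne (fun F hF => (hcard F hF).trans hcol.symm)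
      (hfacet h𝓢) hrig
    rw [hcol] at hle
    refine two_mul_hNum_two_ge hd hmax ?_ ?_
    · rw [h𝓢, fNum_spanned_neg_one hne]
    · rwa [h𝓢, fNum_spanned_zero, fNum_spanned_one]
  rcases hΔ with ⟨F, hF, hΔ⟩ | ⟨c, hc0, hc, hΔ⟩
  · have hFd : #F = d := by
      unfold faceDim at hF
      omega
    refine ⟨{F}, hΔ, singleton_nonempty F, by simpa using hFd, fun T hT => ?_⟩
    have h3 := (card_colorPart (T := T) (hFd.trans hcol.symm)
      (hfacet hΔ F (mem_singleton_self F))).trans hT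
    rw [image_singleton]
    exact (eventually_linearIndependent h3).mono fun p hp => isRigid_singleton h3 hp
  · have hcd : ∀ F ∈ c.support, #F = d := fun F hF => by
      have := (isSimplicialCycle_iff.1 hc.1).1 F hF
      omega
    exact ⟨c.support, hΔ, Finsupp.support_nonempty_iff.2 hc0, hcd, fun T hT =>
      eventually_isRigid_image_colorPart hT hc (fun F hF => (hcd F hF).trans hcol.symm)
        (hfacet hΔ)⟩
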